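/- Let $N\in\mathbb N$, let $\Omega\subset\mathbb R^N$ be a domain (non-empty, open, connected, not necessarily bounded) with Lipschitz boundary, meaning that near each boundary point $\Omega$ is, in suitable orthonormal coordinates, the region above the graph of a Lipschitz function; and let $T>0$. Notation. $A:B=\sum_{i,j}A_{ij}B_{ij}$, $(u\otimes u)_{ij}=u_iu_j$, $(\nabla_x f)_{ij}=\partial f_i/\partial x_j$, and $\mathcal V_N=\{\varphi\in C_c^\infty(\Omega,\mathbb R^N):\operatorname{div}\varphi=0\}$. Let $L_N$ be the closure of $\mathcal V_N$ in $L^2(\Omega,\mathbb R^N)$, $H_N$ its closure in $H^1_0(\Omega,\mathbb R^N)$, $V_N$ its completion with respect to the norm $\big(\int_\Omega|\nabla\varphi|^2dx\big)^{1/2}$, and $V_N^{-1}$ the dual of $V_N$. A test field is a $\psi\in C_c^\infty(\Omega\times(0,T),\mathbb R^N)$ with $\operatorname{div}_x\psi=0$. We write $\partial_t u\in L^2(0,T;V_N^{-1})$ if there is $v\in L^2(0,T;V_N^{-1})$ such that $-\int_0^T\!\int_\Omega u\cdot\partial_t\psi\,dx\,dt=\int_0^T\langle v(t),\psi(\cdot,t)\rangle\,dt$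 for all test fields $\psi$. Let $\mathcal R'$ be the set of all $u\in L^2(0,T;H_N)\cap L^\infty(0,T;L_N)$ such that $\partial_t u\in L^2(0,T;V_N^{-1})$ and $t\mapsto u(\cdot,t)$ is weakly continuous from $[0,T]$ to $L_N$, and let $\mathcal P=\mathcal R'\cap L^4(\Omega\times(0,T),\mathbb R^N)$. For $u\in\mathcal P$ let $\bar H_u\in L^2(0,T;V_N)$ be the function determined by $$\int_0^T\!\!\int_\Omega\big(u\cdot\partial_t\psi+(u\otimes u):\nabla_x\psi\big)\,dx\,dt=\int_0^T\!\!\int_\Omega\nabla_x\bar H_u:\nabla_x\psi\,dx\,dt\qquad\text{for all test fields }\psi .$$ For $r\in L^2(0,T;V_N)$ and $u\in\mathcal P$ put $$J_r(u)=\frac12\Big(\int_0^T\!\!\int_\Omega\big(|\nabla_xu+\nabla_xr|^2+|\nabla_x\bar H_u-\nabla_xr|^2\big)\,dx\,dt+\int_\Omega|u(x,T)|^2\,dx\Big).$$ **Theorem.** Let $v_0\in L_N$ and $r\in L^2(0,T;V_N)$. Assume that there is $u\in\mathcal P$ with $u(\cdot,0)=v_0$ which satisfies $$\int_0^T\!\!\int_\Omega\big(u\cdot\partial_t\psi+(u\otimes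 u):\nabla_x\psi\big)\,dx\,dt=\int_0^T\!\!\int_\Omega(\nabla_xu+\nabla_xr):\nabla_x\psi\,dx\,dt\qquad\text{for all test fields }\psi, \tag{1}$$ that is, $\Delta_xu=\partial_tu+\operatorname{div}_x(u\otimes u)+\nabla_xp-\Delta_xr$ weakly. Then $u$ is a minimizer of $J_r$ over the set $\{w\in\mathcal P: w(\cdot,0)=v_0\}$. Moreover, every minimizer $\bar u$ of $J_r$ over this set also satisfies (1). -/

import Mathlib

open MeasureTheory Set
open scoped ContDiff

noncomputable section

namespace NavierStokesVar

/-- Euclidean space `ℝ^N`. -/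
abbrev E (N : ℕ) : Type := EuclideanSpace ℝ (Fin N)

/-- Real `N × N` matrices with the Frobenius inner product: `inner ℝ A B` is `A : B`. -/
abbrev Mat (N : ℕ) : Type := EuclideanSpace ℝ (Fin N × Fin N)

/-- The Jacobian matrix of `f` at `x`, with `(i, j)` entry `∂f_i/∂x_j`. -/
def grad {N : ℕ} (f : E N → E N) (x : E N) : Mat N :=
  WithLp.toLp 2 fun p => (fderiv ℝ f x (EuclideanSpace.single p.2 (1 : ℝ))) p.1

/-- The divergence `∑_i ∂f_i/∂x_i`. -/
def div {N : ℕ} (f : E N → E N) (x : E N) : ℝ :=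
  ∑ i, grad f x (i, i)

/-- The tensor product `a ⊗ b`, with `(i, j)` entry `a_i b_j`. -/
def tensor {N : ℕ} (a b : E N) : Mat N :=
  WithLp.toLp 2 fun p => a p.1 * b p.2

/-- Near each of its boundary points, `Ω` is the region above the graph of a Lipschitz function
over a hyperplane `e^⊥`, the height being measured along the unit vector `e`. -/
def HasLipschitzBoundary {N : ℕ} (Ω : Set (E N)) : Prop :=
  ∀ p ∈ frontier Ω, ∃ ρ > 0, ∃ e : E N, ‖e‖ = 1 ∧
    ∃ (K : NNReal) (γ : (Submodule.span ℝ {e})ᗮ → ℝ), LipschitzWith K γ ∧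
      ∀ x ∈ Metric.ball p ρ,
        (x ∈ Ω ↔ γ ((Submodule.span ℝ {e})ᗮ.orthogonalProjectionOnto x) < inner ℝ e x)

/-- `L²(Ω, ℝ^N)`. -/
abbrev L2E {N : ℕ} (Ω : Set (E N)) : Type := Lp (E N) 2 (volume.restrict Ω)

/-- `L²(Ω, ℝ^{N×N})`. -/
abbrev L2M {N : ℕ} (Ω : Set (E N)) : Type := Lp (Mat N) 2 (volume.restrict Ω)

theorem grad_add {N : ℕ} {f g : E N → E N} (hf : ContDiff ℝ ∞ f) (hg : ContDiff ℝ ∞ g) :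
    grad (f + g) = grad f + grad g := by
  funext x
  ext p
  have h1 : DifferentiableAt ℝ f x := (hf.differentiable (by simp)) x
  have h2 : DifferentiableAt ℝ g x := (hg.differentiable (by simp)) x
  simp [grad, fderiv_add h1 h2]

theorem grad_smul {N : ℕ} {f : E N → E N} (c : ℝ) (hf : ContDiff ℝ ∞ f) :
    grad (c • f) = c • grad f := by
  funext x
  ext p
  have h1 : DifferentiableAt ℝ f x := (hf.differentiable (by simp)) x
  simp [grad, fderiv_const_smul h1]

/-- `𝒱_N`: the smooth divergence free vector fields with compact support in `Ω`. -/
def Vcal {N : ℕ} (Ω : Set (E N)) : Submodule ℝ (E N → E N) where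
  carrier := {φ | ContDiff ℝ ∞ φ ∧ HasCompactSupport φ ∧ tsupport φ ⊆ Ω ∧ ∀ x, div φ x = 0}
  zero_mem' := by
    refine ⟨contDiff_const, HasCompactSupport.zero, by simp, fun x => ?_⟩
    simp [div, grad]
  add_mem' := by
    rintro f g ⟨hf, cf, sf, df⟩ ⟨hg, cg, sg, dg⟩
    refine ⟨hf.add hg, cf.add cg, (tsupport_add f g).trans (union_subset sf sg), fun x => ?_⟩
    have h1 := df x
    have h2 := dg x
    simp only [div] at h1 h2 ⊢
    simp [grad_add hf hg, Finset.sum_add_distrib, h1, h2]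
  smul_mem' := by
    rintro c f ⟨hf, cf, sf, df⟩
    refine ⟨contDiff_const.smul hf, cf.smul_left (f := fun _ => c),
      (tsupport_smul_subset_right (fun _ => c) f).trans sf, fun x => ?_⟩
    have h1 := df x
    simp only [div] at h1 ⊢
    simp [grad_smul c hf, ← Finset.mul_sum, h1]

theorem memLp_of_mem_Vcal {N : ℕ} {Ω : Set (E N)} (φ : Vcal Ω) :
    MemLp (φ : E N → E N) 2 (volume.restrict Ω) :=
  (φ.2.1.continuous.memLp_of_hasCompactSupport φ.2.2.1).restrict Ω

theorem memLp_grad_of_mem_Vcal {N : ℕ} {Ω : Set (E N)} (φ : Vcal Ω) :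
    MemLp (grad (φ : E N → E N)) 2 (volume.restrict Ω) := by
  have h1 : Continuous (fderiv ℝ (φ : E N → E N)) := φ.2.1.continuous_fderiv (by simp)
  have h2 : HasCompactSupport (fderiv ℝ (φ : E N → E N)) := φ.2.2.1.fderiv ℝ
  have h3 : Continuous (grad (φ : E N → E N)) := by
    unfold grad
    fun_prop
  have h4 : HasCompactSupport (grad (φ : E N → E N)) := by
    refine h2.mono fun x hx hx' => hx ?_
    ext p
    simp [grad, hx']
  exact (h3.memLp_of_hasCompactSupport h4).restrict Ω

/-- The class in `L²(Ω, ℝ^N)` of an element of `𝒱_N`. -/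
def toL2 {N : ℕ} (Ω : Set (E N)) : Vcal Ω →ₗ[ℝ] L2E Ω where
  toFun φ := (memLp_of_mem_Vcal φ).toLp _
  map_add' φ ψ := by rw [← MemLp.toLp_add]; rfl
  map_smul' c φ := by rw [RingHom.id_apply, ← MemLp.toLp_const_smul]; rfl

/-- The class in `L²(Ω, ℝ^{N×N})` of the gradient of an element of `𝒱_N`. -/
def gradL2 {N : ℕ} (Ω : Set (E N)) : Vcal Ω →ₗ[ℝ] L2M Ω where
  toFun φ := (memLp_grad_of_mem_Vcal φ).toLp _
  map_add' φ ψ := by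
    rw [← MemLp.toLp_add]
    exact MemLp.toLp_congr _ _ (.of_forall fun x => by
      rw [Submodule.coe_add, grad_add φ.2.1 ψ.2.1])
  map_smul' c φ := by
    rw [RingHom.id_apply, ← MemLp.toLp_const_smul]
    exact MemLp.toLp_congr _ _ (.of_forall fun x => by
      rw [Submodule.coe_smul, grad_smul c φ.2.1])

/-- `L_N`: the closure of `𝒱_N` in `L²(Ω, ℝ^N)`. -/
def LN {N : ℕ} (Ω : Set (E N)) : Submodule ℝ (L2E Ω) :=
  (LinearMap.range (toL2 Ω)).topologicalClosure

/-- `V_N`: the completion of `𝒱_N` for the norm `φ ↦ (∫_Ω |∇φ|²)^{1/2}`. Each element is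
represented by its gradient, which makes the completion a closed subspace of `L²(Ω, ℝ^{N×N})`;
so for `w : VN Ω` the underlying element of `L2M Ω` is `∇w`. (For some unbounded `Ω`, such as the
plane, an element of the completion is a function only up to additive constants.) -/
def VN {N : ℕ} (Ω : Set (E N)) : Submodule ℝ (L2M Ω) :=
  (LinearMap.range (gradL2 Ω)).topologicalClosure

/-- `H_N`: the closure of `𝒱_N` in `H¹_0(Ω, ℝ^N)`. A member `w` of `H¹` is represented by the
pair `(w, ∇w)` in `L²(Ω, ℝ^N) × L²(Ω, ℝ^{N×N})`; the norm on this product is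
`(∫ |w|² + ∫ |∇w|²)^{1/2}`, the norm of `H¹`. -/
def HN {N : ℕ} (Ω : Set (E N)) : Submodule ℝ (WithLp 2 (L2E Ω × L2M Ω)) :=
  (LinearMap.range
    ((WithLp.linearEquiv 2 ℝ (L2E Ω × L2M Ω)).symm.toLinearMap ∘ₗ
      (toL2 Ω).prod (gradL2 Ω))).topologicalClosure

open Classical in
/-- The weak gradient of a function `w` that lies in `H_N` (the second component of a pair in
`HN Ω` is determined by the first one); zero if `w` is not in `H_N`. -/
def weakGrad {N : ℕ} (Ω : Set (E N)) (w : L2E Ω) : L2M Ω :=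
  if h : ∃ G : L2M Ω, WithLp.toLp 2 (w, G) ∈ HN Ω then h.choose else 0

/-- An element of `𝒱_N` as an element of `V_N`. -/
def toVN {N : ℕ} (Ω : Set (E N)) (φ : Vcal Ω) : VN Ω :=
  ⟨gradL2 Ω φ, Submodule.le_topologicalClosure _ ⟨φ, rfl⟩⟩

/-- The test fields: `ψ(t, x)` smooth with compact support in `(0, T) × Ω` and `div_x ψ = 0`. -/
structure TestField {N : ℕ} (Ω : Set (E N)) (T : ℝ) where
  toFun : ℝ × E N → E N
  smooth : ContDiff ℝ ∞ toFun
  compact : HasCompactSupport toFun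
  supp : tsupport toFun ⊆ Ioo 0 T ×ˢ Ω
  divFree : ∀ t x, div (fun y => toFun (t, y)) x = 0

/-- `ψ(t, ·)` as an element of `𝒱_N`. -/
def TestField.slice {N : ℕ} {Ω : Set (E N)} {T : ℝ} (ψ : TestField Ω T) (t : ℝ) : Vcal Ω :=
  ⟨fun x => ψ.toFun (t, x), by
    have hsub : tsupport (fun x => ψ.toFun (t, x)) ⊆ (fun x => (t, x)) ⁻¹' tsupport ψ.toFun :=
      closure_minimal (fun x hx => subset_tsupport _ hx)
        ((isClosed_tsupport _).preimage (by fun_prop))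
    refine ⟨ψ.smooth.comp (contDiff_const.prodMk contDiff_id), ?_, ?_, ψ.divFree t⟩
    · refine HasCompactSupport.of_support_subset_isCompact
        (ψ.compact.isCompact.image continuous_snd) fun x hx => ?_
      exact ⟨(t, x), subset_tsupport _ hx, rfl⟩
    · exact fun x hx => (ψ.supp (hsub hx)).2⟩

/-- The time derivative `∂_t ψ(t, x)`. -/
def TestField.dt {N : ℕ} {Ω : Set (E N)} {T : ℝ} (ψ : TestField Ω T) (t : ℝ) (x : E N) : E N :=
  deriv (fun s => ψ.toFun (s, x)) t

/-- The spatial gradient `∇_x ψ(t, x)`. -/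
def TestField.dx {N : ℕ} {Ω : Set (E N)} {T : ℝ} (ψ : TestField Ω T) (t : ℝ) (x : E N) : Mat N :=
  grad (fun y => ψ.toFun (t, y)) x

/-- Lebesgue measure on the time interval `(0, T)`. -/
def timeMeasure (T : ℝ) : Measure ℝ := volume.restrict (Ioo 0 T)

/-- The distribution `∂_t u` belongs to `L²(0, T; V_N^{-1})`, where `V_N^{-1}` is the dual
of `V_N`: there is `v ∈ L²(0, T; V_N^{-1})` such that `⟨∂_t u, ψ⟩ = - ∫∫ u · ∂_t ψ` equals
`∫ ⟨v(t), ψ(t)⟩ dt` for all test fields. -/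
def TimeDerivMem {N : ℕ} (Ω : Set (E N)) (T : ℝ) (u : ℝ → LN Ω) : Prop :=
  ∃ v : ℝ → StrongDual ℝ (VN Ω), MemLp v 2 (timeMeasure T) ∧
    ∀ ψ : TestField Ω T,
      - ∫ t in Ioo 0 T, ∫ x in Ω, inner ℝ ((u t : L2E Ω) x) (ψ.dt t x)
        = ∫ t in Ioo 0 T, v t (toVN Ω (ψ.slice t))

/-- The class `ℛ'`: `u ∈ L²(0, T; H_N) ∩ L^∞(0, T; L_N)` with `∂_t u ∈ L²(0, T; V_N^{-1})` and
`t ↦ u(t)` weakly continuous from `[0, T]` to `L_N`. -/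
structure MemR {N : ℕ} (Ω : Set (E N)) (T : ℝ) (u : ℝ → LN Ω) : Prop where
  memHN : ∃ U : ℝ → HN Ω, MemLp U 2 (timeMeasure T) ∧
    ∀ᵐ t ∂timeMeasure T, (U t : WithLp 2 (L2E Ω × L2M Ω)).fst = (u t : L2E Ω)
  memLinfty : MemLp u ⊤ (timeMeasure T)
  timeDeriv : TimeDerivMem Ω T u
  weakCont : ∀ w : LN Ω, ContinuousOn (fun t => inner ℝ (u t) w) (Icc 0 T)

/-- The class `𝒫 = ℛ' ∩ L⁴(Ω × (0, T), ℝ^N)`. -/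
structure MemP {N : ℕ} (Ω : Set (E N)) (T : ℝ) (u : ℝ → LN Ω) : Prop extends MemR Ω T u where
  memL4 : ∫⁻ t in Ioo 0 T, ∫⁻ x in Ω, ‖(u t : L2E Ω) x‖ₑ ^ 4 < ⊤

/-- `∫_0^T ∫_Ω (u · ∂_t ψ + (u ⊗ u) : ∇_x ψ) dx dt`. -/
def evolutionForm {N : ℕ} {Ω : Set (E N)} {T : ℝ} (u : ℝ → LN Ω) (ψ : TestField Ω T) : ℝ :=
  ∫ t in Ioo 0 T, ∫ x in Ω,
    (inner ℝ ((u t : L2E Ω) x) (ψ.dt t x)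
      + inner ℝ (tensor ((u t : L2E Ω) x) ((u t : L2E Ω) x)) (ψ.dx t x))

/-- `H ∈ L²(0, T; V_N)` represents `∂_t u + div_x (u ⊗ u)`:
`∫∫ (u · ∂_t ψ + (u ⊗ u) : ∇_x ψ) = ∫∫ ∇_x H : ∇_x ψ` for all test fields `ψ`. -/
def IsHbar {N : ℕ} (Ω : Set (E N)) (T : ℝ) (u : ℝ → LN Ω) (H : ℝ → VN Ω) : Prop :=
  MemLp H 2 (timeMeasure T) ∧
    ∀ ψ : TestField Ω T,
      evolutionForm u ψ = ∫ t in Ioo 0 T, ∫ x in Ω, inner ℝ ((H t : L2M Ω) x) (ψ.dx t x)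

open Classical in
/-- The function `H̄_u`; for `u ∈ 𝒫` it exists and is unique up to a null set of times. -/
def Hbar {N : ℕ} (Ω : Set (E N)) (T : ℝ) (u : ℝ → LN Ω) : ℝ → VN Ω :=
  if h : ∃ H : ℝ → VN Ω, IsHbar Ω T u H then h.choose else 0

/-- The functional
`J_r(u) = ½ (∫_0^T ∫_Ω (|∇u + ∇r|² + |∇H̄_u - ∇r|²) dx dt + ∫_Ω |u(x, T)|² dx)`;
the norms are those of `L²(Ω)`. -/
def J {N : ℕ} (Ω : Set (E N)) (T : ℝ) (r : ℝ → VN Ω) (u : ℝ → LN Ω) : ℝ :=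
  1 / 2 * ((∫ t in Ioo 0 T,
      (‖weakGrad Ω (u t : L2E Ω) + (r t : L2M Ω)‖ ^ 2
        + ‖(Hbar Ω T u t : L2M Ω) - (r t : L2M Ω)‖ ^ 2))
    + ‖u T‖ ^ 2)

/-- `u` solves `Δu = ∂_t u + div_x (u ⊗ u) + ∇p - Δr` weakly:
`∫∫ (u · ∂_t ψ + (u ⊗ u) : ∇_x ψ) = ∫∫ (∇_x u + ∇_x r) : ∇_x ψ` for all test fields `ψ`. -/
def IsWeakSolution {N : ℕ} (Ω : Set (E N)) (T : ℝ) (r : ℝ → VN Ω) (u : ℝ → LN Ω) : Prop :=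
  ∀ ψ : TestField Ω T,
    evolutionForm u ψ
      = ∫ t in Ioo 0 T, ∫ x in Ω,
          inner ℝ ((weakGrad Ω (u t : L2E Ω)) x + (r t : L2M Ω) x) (ψ.dx t x)

/-- `u` minimizes `J_r` over the members of `𝒫` with initial datum `v₀`. -/
def IsMinimizer {N : ℕ} (Ω : Set (E N)) (T : ℝ) (r : ℝ → VN Ω) (v₀ : LN Ω)
    (u : ℝ → LN Ω) : Prop :=
  MemP Ω T u ∧ u 0 = v₀ ∧ ∀ w : ℝ → LN Ω, MemP Ω T w → w 0 = v₀ → J Ω T r u ≤ J Ω T r w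

end NavierStokesVar

end

open Filter Topology

/-! On `𝒫` the functional is a nonnegative defect plus a constant fixed by the data. Write `G = ∇u`,
`H = ∇H̄_u`. Pointwise in time, `|G + r|² + |H - r|² = |G + r - H|² + |r|² + 2⟨H, G⟩`, and the
energy identity `‖u(T)‖² + 2∫⟨H, G⟩ = ‖u(0)‖²` absorbs the last term together with `‖u(T)‖²`. Hence
`J_r(u) = ½(∫|G + r - H|² + ∫|r|² + ‖v₀‖²)` (`MemP.J_eq`). Equation (1) says exactly that `H = G +
r`, so a solution attains the lower bound `½(∫|r|² + ‖v₀‖²)`; as this value is attained, every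
minimizer has zero defect and solves (1).

The work lies in the energy identity `MemP.energy`. In the dual of `V_N` one has `∂_t u = stress u -
H`, where `stress u` is the projection of `u ⊗ u` onto `V_N`. Pairing with `u` requires two facts.

The first is the chain rule `‖u(T)‖² - ‖u(0)‖² = 2∫⟨∂_t u, u⟩` (`energy_identity`). It comes from
symmetric difference quotients: `∫⟨u(t+h) - u(t-h), u(t)⟩ dt` telescopes to boundary terms, and it
is also an integral over `[-h, h]` of a continuous correlation function. Comparing derivatives at `h
= 0` gives the claim, with weak continuity of `u` as the only regularity in `L_N`.

The second is the cancellation `∫ (u ⊗ u) : ∇u = 0` (`integral_inner_tensor_self_eq_zero`). Smooth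
approximants converge in `H¹` but not necessarily in `L⁴`, so one factor is replaced by a bounded
truncation that is itself a gradient field; the truncation is removed at the end by the `L⁴` bound.
-/

/-! ### Hilbert space valued functions of time and the abstract energy identity. -/

/-- Orthonormal vectors are `√2` apart, so no point of a countable dense set is within `1/2` of two
of them. -/
theorem Orthonormal.countable_of_separable {X ι : Type*} [NormedAddCommGroup X]
    [InnerProductSpace ℝ X] [TopologicalSpace.SeparableSpace X] {b : ι → X}
    (hb : Orthonormal ℝ b) : Countable ι := by
  obtain ⟨s, hsc, hsd⟩ := TopologicalSpace.exists_countable_dense X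
  have hex : ∀ i, ∃ x ∈ s, dist (b i) x < 1 / 2 := fun i =>
    Metric.dense_iff.1 hsd (b i) (1 / 2) (by norm_num) |>.imp fun x hx =>
      ⟨hx.2, by simpa [dist_comm] using hx.1⟩
  choose g hg hgd using hex
  have hinj : Function.Injective g := by
    intro i j hij
    by_contra hne
    have h1 : dist (b i) (b j) < 1 := by
      have h2 := dist_triangle_right (b i) (b j) (g i)
      have h3 := hgd i
      have h4 := hgd j
      rw [← hij] at h4
      linarith
    have h5 : ‖b i - b j‖ ^ 2 = 2 := by
      rw [norm_sub_sq_real, hb.1 i, hb.1 j, hb.2 hne]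
      norm_num
    rw [dist_eq_norm] at h1
    nlinarith [norm_nonneg (b i - b j)]
  have : Countable s := hsc
  exact Function.Injective.countable (f := fun i => (⟨g i, hg i⟩ : s))
    fun i j h => hinj (congrArg Subtype.val h)

/-- In a separable Hilbert space, weak measurability implies strong measurability. -/
theorem aestronglyMeasurable_of_inner {α X : Type*} [MeasurableSpace α] {μ : Measure α}
    [NormedAddCommGroup X] [InnerProductSpace ℝ X] [CompleteSpace X]
    [TopologicalSpace.SeparableSpace X] {f : α → X}
    (h : ∀ x, AEStronglyMeasurable (fun a => (inner ℝ x (f a) : ℝ)) μ) :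
    AEStronglyMeasurable f μ := by
  obtain ⟨w, b, -⟩ := exists_hilbertBasis ℝ X
  have : Countable w := b.orthonormal.countable_of_separable
  refine aestronglyMeasurable_of_tendsto_ae (ι := Finset w) atTop
    (f := fun s a => ∑ i ∈ s, (inner ℝ (b i) (f a) : ℝ) • b i) (fun s => ?_)
    (.of_forall fun a => ?_)
  · exact Finset.aestronglyMeasurable_fun_sum _ fun i _ => (h (b i)).smul_const _
  · have := b.hasSum_repr (f a)
    simpa only [HasSum, b.repr_apply_apply, SummationFilter.unconditional_filter] using this

/-- Translation acts continuously on `L²(ℝ; X)`, and the integral is an inner product with a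
translate. -/
theorem continuous_integral_inner_translate {X : Type*} [NormedAddCommGroup X]
    [InnerProductSpace ℝ X] {F G : ℝ → X} (hF : MemLp F 2 volume)
    (hG : MemLp G 2 volume) : Continuous fun σ => ∫ t, (inner ℝ (F (σ + t)) (G t) : ℝ) := by
  have hfact : Fact ((2 : ENNReal) ≠ ⊤) := ⟨by simp⟩
  have h1 : ∀ σ, ∫ t, (inner ℝ (F (σ + t)) (G t) : ℝ)
      = inner ℝ (DomAddAct.mk σ +ᵥ hF.toLp F) (hG.toLp G) := by
    intro σ
    rw [L2.inner_def]
    refine integral_congr_ae ?_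
    have h2 := DomAddAct.vadd_Lp_ae_eq (DomAddAct.mk σ) (hF.toLp F)
    have h3 := (measurePreserving_add_left (volume : Measure ℝ) σ).quasiMeasurePreserving.ae_eq_comp
      hF.coeFn_toLp
    filter_upwards [h2, h3, hG.coeFn_toLp] with t e2 e3 e4
    rw [e2, e4]
    simp only [Function.comp] at e3
    simp [e3]
  simp_rw [h1]
  have h4 : Continuous fun σ : ℝ => DomAddAct.mk σ +ᵥ hF.toLp F :=
    (continuous_id.vadd continuous_const).comp DomAddAct.continuous_mk
  fun_prop

/-- Justifies Fubini for the correlation integral: the shear `(σ, t) ↦ (σ, σ + t)` preserves the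
product measure, so both factors are square integrable over a strip of finite width. -/
theorem integrable_inner_translate {X : Type*} [NormedAddCommGroup X]
    [InnerProductSpace ℝ X] {F G : ℝ → X} (hF : MemLp F 2 volume)
    (hG : MemLp G 2 volume) (μ : Measure ℝ) [IsFiniteMeasure μ] :
    Integrable (fun p : ℝ × ℝ => (inner ℝ (F (p.1 + p.2)) (G p.2) : ℝ)) (μ.prod volume) := by
  have hsh := measurePreserving_prod_add μ (volume : Measure ℝ)
  have hqs := (Measure.quasiMeasurePreserving_snd (μ := μ) (ν := (volume : Measure ℝ)))
  have m1 : AEStronglyMeasurable (fun p : ℝ × ℝ => F (p.1 + p.2)) (μ.prod volume) :=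
    (hF.1.comp_quasiMeasurePreserving hqs).comp_quasiMeasurePreserving hsh.quasiMeasurePreserving
  have m2 : AEStronglyMeasurable (fun p : ℝ × ℝ => G p.2) (μ.prod volume) :=
    hG.1.comp_quasiMeasurePreserving hqs
  have i1 : Integrable (fun p : ℝ × ℝ => ‖F p.2‖ ^ 2) (μ.prod volume) :=
    Integrable.comp_snd (f := fun t => ‖F t‖ ^ 2) (hF.integrable_norm_pow two_ne_zero) μ
  have i2 : Integrable (fun p : ℝ × ℝ => ‖G p.2‖ ^ 2) (μ.prod volume) :=
    Integrable.comp_snd (f := fun t => ‖G t‖ ^ 2) (hG.integrable_norm_pow two_ne_zero) μ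
  have i3 : Integrable (fun p : ℝ × ℝ => ‖F (p.1 + p.2)‖ ^ 2) (μ.prod volume) :=
    hsh.integrable_comp_of_integrable i1
  refine (i3.add i2).mono' (m1.inner m2) (.of_forall fun p => ?_)
  have := norm_inner_le_norm (𝕜 := ℝ) (F (p.1 + p.2)) (G p.2)
  simp only [Pi.add_apply]
  nlinarith [sq_nonneg (‖F (p.1 + p.2)‖ - ‖G p.2‖), norm_nonneg (F (p.1 + p.2)),
    norm_nonneg (G p.2)]

/-- Extending `u` by constants outside `[0, T]` corresponds to extending its derivative by zero. -/
theorem integral_projIcc_eq {T : ℝ} (hT : 0 < T) (f : ℝ → ℝ) {a b : ℝ} (hab : a ≤ b) :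
    ∫ τ in (projIcc 0 T hT.le a : ℝ)..(projIcc 0 T hT.le b : ℝ), f τ
      = ∫ τ in a..b, (Ioo 0 T).indicator f τ := by
  have hp : (projIcc 0 T hT.le a : ℝ) ≤ projIcc 0 T hT.le b := monotone_projIcc hT.le hab
  rw [intervalIntegral.integral_of_le hp, intervalIntegral.integral_of_le hab,
    integral_Ioc_eq_integral_Ioo, integral_Ioc_eq_integral_Ioo,
    setIntegral_indicator measurableSet_Ioo]
  congr 2
  ext x
  simp only [coe_projIcc, mem_Ioo, mem_inter_iff, max_lt_iff, lt_max_iff, min_lt_iff, lt_min_iff]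
  constructor
  · rintro ⟨⟨h1, h2⟩, h3⟩
    rcases h2 with h2 | h2 <;> rcases h3 with h3 | h3 <;> first | (exfalso; linarith) | skip
    all_goals exact ⟨⟨by linarith, by linarith [h3.2]⟩, h1, h3.1⟩
  · rintro ⟨⟨h1, h2⟩, h3, h4⟩
    exact ⟨⟨h3, .inr h1⟩, .inr ⟨h4, h2⟩⟩

/-- Uniform boundedness principle for the functionals `⟨u t, ·⟩`. -/
theorem norm_bounded_of_weakly_continuousOn {L : Type*} [NormedAddCommGroup L]
    [InnerProductSpace ℝ L] [CompleteSpace L] {u : ℝ → L} {K : Set ℝ} (hK : IsCompact K)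
    (hu : ∀ w, ContinuousOn (fun t => (inner ℝ (u t) w : ℝ)) K) :
    ∃ M, ∀ t ∈ K, ‖u t‖ ≤ M := by
  obtain ⟨M, hM⟩ := banach_steinhaus (g := fun t : K => innerSL ℝ (u t)) fun w => by
    obtain ⟨C, hC⟩ := hK.exists_bound_of_continuousOn (hu w)
    exact ⟨C, fun t => by simpa using hC t t.2⟩
  exact ⟨M, fun t ht => by simpa using hM ⟨t, ht⟩⟩

/-- The energy identity of Lions and Magenes: `u` is weakly continuous in `L`, its increments are
integrals of `F` when tested with the values of `u`, and `G` pairs the values of `u` with `F`. -/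
theorem energy_identity {L X : Type*} [NormedAddCommGroup L] [InnerProductSpace ℝ L]
    [CompleteSpace L] [TopologicalSpace.SeparableSpace L] [NormedAddCommGroup X]
    [InnerProductSpace ℝ X] {T : ℝ} (hT : 0 < T) {u : ℝ → L}
    (hu : ∀ w, ContinuousOn (fun t => (inner ℝ (u t) w : ℝ)) (Icc 0 T)) {F G : ℝ → X}
    (hF : MemLp F 2 (volume.restrict (Ioo 0 T))) (hG : MemLp G 2 (volume.restrict (Ioo 0 T)))
    (hinc : ∀ᵐ t ∂volume.restrict (Ioo 0 T), ∀ s ∈ Icc 0 T, ∀ s' ∈ Icc 0 T,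
      (inner ℝ (u s' - u s) (u t) : ℝ) = ∫ τ in s..s', inner ℝ (F τ) (G t)) :
    ‖u T‖ ^ 2 - ‖u 0‖ ^ 2 = 2 * ∫ t in Ioo 0 T, inner ℝ (F t) (G t) := by
  -- `U` continues `u` by its end values, so that `U (t ± h)` makes sense for every `t`.
  set p : ℝ → Icc 0 T := projIcc 0 T hT.le with hp
  set U : ℝ → L := fun t => u (p t) with hU
  have hUc : ∀ w, Continuous fun t => (inner ℝ (U t) w : ℝ) := fun w =>
    (continuousOn_iff_continuous_domRestrict.1 (hu w)).comp continuous_projIcc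
  have hUm : AEStronglyMeasurable U volume := aestronglyMeasurable_of_inner fun w => by
    simpa only [real_inner_comm] using (hUc w).aestronglyMeasurable
  have hUin : ∀ t ∈ Icc 0 T, U t = u t := fun t ht => by
    simp only [hU, hp, projIcc_of_mem hT.le ht]
  have hUl : ∀ t ≤ 0, U t = u 0 := fun t ht => by
    simp only [hU, hp, projIcc_of_le_left hT.le ht]
  have hUr : ∀ t, T ≤ t → U t = u T := fun t ht => by
    simp only [hU, hp, projIcc_of_right_le hT.le ht]
  obtain ⟨M, hM⟩ := norm_bounded_of_weakly_continuousOn isCompact_Icc hu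
  have hUM : ∀ t, ‖U t‖ ≤ M := fun t => hM _ (p t).2
  have hM0 : 0 ≤ M := (norm_nonneg _).trans (hUM 0)
  set F0 := (Ioo 0 T).indicator F with hF0
  set G0 := (Ioo 0 T).indicator G with hG0
  have hF0m : MemLp F0 2 volume := (memLp_indicator_iff_restrict measurableSet_Ioo).2 hF
  have hG0m : MemLp G0 2 volume := (memLp_indicator_iff_restrict measurableSet_Ioo).2 hG
  set A : ℝ → ℝ := fun σ => ∫ t, (inner ℝ (F0 (σ + t)) (G0 t) : ℝ) with hA
  have hAc : Continuous A := continuous_integral_inner_translate hF0m hG0m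
  have hA0 : A 0 = ∫ t in Ioo 0 T, inner ℝ (F t) (G t) := by
    rw [← integral_indicator measurableSet_Ioo]
    refine integral_congr_ae (.of_forall fun t => ?_)
    by_cases ht : t ∈ Ioo 0 T <;> simp [hF0, hG0, ht]
  -- The increment over `[t - h, t + h]` is tested with `u t` itself; `hinc` allows this for almost
  -- every `t`, with one null set for all increments.
  have key : ∀ h, 0 ≤ h → ∀ᵐ t ∂volume.restrict (Ioo 0 T),
      (inner ℝ (U (t + h) - U (t - h)) (U t) : ℝ)
        = ∫ σ in Ioc (-h) h, inner ℝ (F0 (σ + t)) (G0 t) := by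
    intro h hh
    filter_upwards [hinc, ae_restrict_mem measurableSet_Ioo] with t ht htm
    rw [hUin t (Ioo_subset_Icc_self htm), hU]
    simp only
    rw [ht _ (p (t - h)).2 _ (p (t + h)).2, hp, integral_projIcc_eq hT _ (by linarith),
      ← intervalIntegral.integral_of_le (by linarith),
      intervalIntegral.integral_comp_add_right (fun s => (inner ℝ (F0 s) (G0 t) : ℝ))]
    have e1 : -h + t = t - h := by ring
    rw [e1, add_comm h t]
    refine intervalIntegral.integral_congr fun s _ => ?_
    by_cases hs : s ∈ Ioo 0 T <;> simp [hF0, hG0, hs, htm]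
  have right : ∀ h, 0 ≤ h → ∫ t in Ioo 0 T, (inner ℝ (U (t + h) - U (t - h)) (U t) : ℝ)
      = ∫ σ in -h..h, A σ := by
    intro h hh
    rw [integral_congr_ae (key h hh), intervalIntegral.integral_of_le (by linarith),
      integral_integral_swap (f := fun t σ => (inner ℝ (F0 (σ + t)) (G0 t) : ℝ))
        ((integrable_inner_translate hF0m hG0m (volume.restrict (Ioc (-h) h))).swap.mono_measure
          (Measure.prod_mono Measure.restrict_le_self le_rfl))]
    refine integral_congr_ae (.of_forall fun σ => ?_)
    simp only [hA]
    rw [← integral_indicator measurableSet_Ioo]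
    refine integral_congr_ae (.of_forall fun t => ?_)
    by_cases ht : t ∈ Ioo 0 T <;> simp [hG0, ht]
  have hfi : ∀ h a b, IntervalIntegrable (fun t => (inner ℝ (U (t + h)) (U t) : ℝ)) volume a b := by
    intro h a b
    have hm : AEStronglyMeasurable (fun t => U (t + h)) volume :=
      hUm.comp_quasiMeasurePreserving
        (measurePreserving_add_right (volume : Measure ℝ) h).quasiMeasurePreserving
    refine (intervalIntegrable_const (c := M * M)).mono_fun' (hm.inner hUm).restrict
      (.of_forall fun t => ?_)
    exact (norm_inner_le_norm _ _).trans (mul_le_mul (hUM _) (hUM _) (norm_nonneg _) hM0)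
  have left : ∀ h, 0 ≤ h → h ≤ T → ∫ t in Ioo 0 T, (inner ℝ (U (t + h) - U (t - h)) (U t) : ℝ)
      = (∫ t in (T - h)..T, inner ℝ (U t) (u T)) - ∫ t in (0 : ℝ)..h, inner ℝ (U t) (u 0) := by
    intro h h0 h1
    set f : ℝ → ℝ := fun t => inner ℝ (U (t + h)) (U t) with hf
    have e1 : ∀ t, (inner ℝ (U (t + h) - U (t - h)) (U t) : ℝ) = f t - f (t - h) := by
      intro t
      simp only [hf, inner_sub_left, sub_add_cancel]
      rw [real_inner_comm (U t) (U (t - h))]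
    have e2 : IntervalIntegrable (fun t => f (t - h)) volume 0 T := by
      simpa only [hf, sub_add_cancel] using (hfi h (0 - h) (T - h)).comp_sub_right h
    simp_rw [e1]
    -- By symmetry of the inner product the integrand is `f t - f (t - h)`; the integrals over `[0,
    -- T]` and `[-h, T - h]` share `[0, T - h]`, so only two end intervals of length `h` survive.
    rw [← integral_Ioc_eq_integral_Ioo, ← intervalIntegral.integral_of_le hT.le,
      intervalIntegral.integral_sub (hfi h 0 T) e2, intervalIntegral.integral_comp_sub_right,
      ← intervalIntegral.integral_add_adjacent_intervals (hfi h 0 (T - h)) (hfi h (T - h) T),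
      ← intervalIntegral.integral_add_adjacent_intervals (hfi h (0 - h) 0) (hfi h 0 (T - h))]
    have e3 : ∫ t in (T - h)..T, f t = ∫ t in (T - h)..T, inner ℝ (U t) (u T) := by
      refine intervalIntegral.integral_congr fun t ht => ?_
      rw [uIcc_of_le (by linarith)] at ht
      simp only [hf]
      rw [hUr (t + h) (by linarith [ht.1]), real_inner_comm]
    have e4 : ∫ t in (0 - h)..0, f t = ∫ t in (0 : ℝ)..h, inner ℝ (U t) (u 0) := by
      have := intervalIntegral.integral_comp_add_right (a := 0 - h) (b := 0)
        (fun t => (inner ℝ (U t) (u 0) : ℝ)) h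
      rw [sub_add_cancel, zero_add] at this
      rw [← this]
      refine intervalIntegral.integral_congr fun t ht => ?_
      rw [uIcc_of_le (by linarith)] at ht
      simp only [hf]
      rw [hUl t ht.2]
    have e5 : ∫ t in (0 - h)..(T - h), f t = (∫ t in (0 - h)..0, f t) + ∫ t in (0 : ℝ)..(T - h), f t :=
      (intervalIntegral.integral_add_adjacent_intervals (hfi h (0 - h) 0) (hfi h 0 (T - h))).symm
    rw [← e3, ← e4]
    linarith
  -- `D` vanishes on `[0, T]` by `left` and `right`, while its derivative at `0` is `‖u T‖² - ‖u 0‖²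
  -- - 2 A 0`. The one-sided derivative suffices to equate the two.
  set D : ℝ → ℝ := fun h => (∫ t in (T - h)..T, inner ℝ (U t) (u T))
      - (∫ t in (0 : ℝ)..h, inner ℝ (U t) (u 0)) - ∫ σ in -h..h, A σ with hD
  have hderiv : HasDerivAt D ((inner ℝ (U T) (u T) : ℝ) - inner ℝ (U 0) (u 0) - (A 0 + A 0)) 0 := by
    refine HasDerivAt.sub (HasDerivAt.sub ?_ ?_) ?_
    · have h1 := intervalIntegral.integral_hasDerivAt_left (b := T) (a := T - 0)
        ((hUc (u T)).intervalIntegrable _ _) (hUc (u T)).stronglyMeasurable.stronglyMeasurableAtFilter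
        (hUc (u T)).continuousAt
      have h2 := h1.comp (0 : ℝ) ((hasDerivAt_id (0 : ℝ)).const_sub T)
      simpa [Function.comp_def] using h2
    · exact intervalIntegral.integral_hasDerivAt_right
        ((hUc (u 0)).intervalIntegrable _ _) (hUc (u 0)).stronglyMeasurable.stronglyMeasurableAtFilter
        (hUc (u 0)).continuousAt
    · have hr := fun x : ℝ => intervalIntegral.integral_hasDerivAt_right (a := 0) (b := x)
        (hAc.intervalIntegrable _ _) hAc.stronglyMeasurable.stronglyMeasurableAtFilter
        hAc.continuousAt
      have h1 := hr (-0)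
      have h2 := (h1.comp (0 : ℝ) (hasDerivAt_neg (0 : ℝ)))
      have h3 := (hr 0).sub h2
      have h4 : (fun h => ∫ σ in -h..h, A σ)
          = (fun x => ∫ σ in (0 : ℝ)..x, A σ) - (fun x => ∫ σ in (0 : ℝ)..x, A σ) ∘ Neg.neg := by
        funext h
        simp only [Pi.sub_apply, Function.comp]
        rw [← intervalIntegral.integral_add_adjacent_intervals
          (hAc.intervalIntegrable (-h) 0) (hAc.intervalIntegrable 0 h),
          intervalIntegral.integral_symm 0 (-h)]
        ring
      rw [h4]
      convert h3 using 1
      simp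
  have hzero : HasDerivWithinAt D 0 (Ici 0) 0 := by
    refine (hasDerivWithinAt_const (0 : ℝ) (Ici 0) (0 : ℝ)).congr_of_eventuallyEq_of_mem ?_
      self_mem_Ici
    have : Icc 0 T ∈ 𝓝[Ici 0] (0 : ℝ) := Icc_mem_nhdsGE hT
    filter_upwards [this] with h hh
    simp only [hD]
    rw [← left h hh.1 hh.2, right h hh.1, sub_self]
  have := (uniqueDiffWithinAt_Ici (0 : ℝ)).eq_deriv _ hderiv.hasDerivWithinAt hzero
  rw [hUin T (right_mem_Icc.2 hT.le), hUin 0 (left_mem_Icc.2 hT.le),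
    real_inner_self_eq_norm_sq, real_inner_self_eq_norm_sq, hA0] at this
  linarith

/-! ### Recovering increments from a weak time derivative. -/

theorem Real.smoothTransition.hasCompactSupport_deriv :
    HasCompactSupport (deriv Real.smoothTransition) := by
  refine HasCompactSupport.of_support_subset_isCompact (isCompact_Icc (a := (0 : ℝ)) (b := 1))
    fun x hx => ?_
  by_contra hx'
  refine hx ?_
  rw [mem_Icc, not_and_or, not_le, not_le] at hx'
  rcases hx' with h | h
  · have : Real.smoothTransition =ᶠ[𝓝 x] fun _ => 0 := by
      filter_upwards [Iio_mem_nhds h] with y hy using Real.smoothTransition.zero_of_nonpos hy.le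
    rw [this.deriv_eq, deriv_const]
  · have : Real.smoothTransition =ᶠ[𝓝 x] fun _ => 1 := by
      filter_upwards [Ioi_mem_nhds h] with y hy using Real.smoothTransition.one_of_one_le hy.le
    rw [this.deriv_eq, deriv_const]

theorem Real.smoothTransition.differentiable : Differentiable ℝ Real.smoothTransition :=
  (Real.smoothTransition.contDiff (n := 1)).differentiable (by simp)

theorem Real.smoothTransition.continuous_deriv : Continuous (deriv Real.smoothTransition) :=
  (Real.smoothTransition.contDiff (n := 1)).continuous_deriv (by simp)

theorem Real.smoothTransition.integral_deriv : ∫ x, deriv Real.smoothTransition x = 1 := by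
  have h := integral_of_hasDerivAt_of_tendsto (f := Real.smoothTransition) (m := 0) (n := 1)
    (fun x => (Real.smoothTransition.differentiable x).hasDerivAt)
    (Real.smoothTransition.continuous_deriv.integrable_of_hasCompactSupport
      Real.smoothTransition.hasCompactSupport_deriv)
    (tendsto_const_nhds.congr' (by
      filter_upwards [eventually_le_atBot 0] with y hy
        using (Real.smoothTransition.zero_of_nonpos hy).symm))
    (tendsto_const_nhds.congr' (by
      filter_upwards [eventually_ge_atTop 1] with y hy
        using (Real.smoothTransition.one_of_one_le hy).symm))
  simpa using h

/-- The functions `t ↦ n S'(n (t - a))`, with `S` the smooth transition, form an approximate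
identity at `a`. -/
theorem tendsto_integral_smoothTransition_deriv {f : ℝ → ℝ} (hf : Continuous f) {M : ℝ}
    (hM : ∀ t, |f t| ≤ M) (a : ℝ) :
    Tendsto (fun n : ℕ => ∫ t, f t * (n * deriv Real.smoothTransition (n * (t - a)))) atTop
      (𝓝 (f a)) := by
  have h1 : ∀ᶠ n : ℕ in atTop, ∫ x, f (a + x / n) * deriv Real.smoothTransition x
      = ∫ t, f t * (n * deriv Real.smoothTransition (n * (t - a))) := by
    -- Substitution `t = a + x / n`, which moves the dependence on `n` into the argument of `f`.
    filter_upwards [eventually_gt_atTop 0] with n hn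
    have hn' : (0 : ℝ) < n := by exact_mod_cast hn
    have h2 := Measure.integral_comp_mul_left
      (fun x => f (a + x / n) * deriv Real.smoothTransition x) (n : ℝ)
    have h3 := integral_sub_right_eq_self (μ := (volume : Measure ℝ))
      (fun t : ℝ => f (a + n * t / n) * deriv Real.smoothTransition (n * t)) a
    rw [← h3, abs_of_pos (inv_pos.2 hn'), smul_eq_mul, eq_inv_mul_iff_mul_eq₀ hn'.ne'] at h2
    rw [← h2, ← integral_const_mul]
    refine integral_congr_ae (.of_forall fun t => ?_)
    have : a + n * (t - a) / n = t := by field_simp; ring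
    simp only [this]
    ring
  refine Tendsto.congr' h1 ?_
  have h4 : f a = ∫ x, f a * deriv Real.smoothTransition x := by
    rw [integral_const_mul, Real.smoothTransition.integral_deriv, mul_one]
  rw [h4]
  have hS := Real.smoothTransition.continuous_deriv
  refine tendsto_integral_of_dominated_convergence
    (fun x => M * |deriv Real.smoothTransition x|) (fun n => ?_) ?_ (fun n => ?_) ?_
  · exact (by fun_prop : Continuous _).aestronglyMeasurable
  · exact ((hS.integrable_of_hasCompactSupport
      Real.smoothTransition.hasCompactSupport_deriv).abs).const_mul M
  · refine .of_forall fun x => ?_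
    rw [Real.norm_eq_abs, abs_mul]
    exact mul_le_mul_of_nonneg_right (hM _) (abs_nonneg _)
  · refine .of_forall fun x => ?_
    have h5 : Tendsto (fun n : ℕ => a + x / n) atTop (𝓝 (a + 0)) :=
      (tendsto_const_div_atTop_nhds_zero_nat x).const_add a
    rw [add_zero] at h5
    exact ((hf.tendsto a).comp h5).mul_const _

theorem tendsto_smoothTransition_step (a t : ℝ) :
    Tendsto (fun n : ℕ => Real.smoothTransition (n * (t - a))) atTop
      (𝓝 ((Ioi a).indicator (fun _ => 1) t)) := by
  by_cases h : a < t
  · rw [indicator_of_mem (mem_Ioi.2 h)]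
    refine tendsto_const_nhds.congr' ?_
    filter_upwards [(tendsto_natCast_atTop_atTop (R := ℝ)).eventually_ge_atTop (1 / (t - a))]
      with n hn
    refine (Real.smoothTransition.one_of_one_le ?_).symm
    rwa [div_le_iff₀ (by linarith)] at hn
  · rw [indicator_of_notMem (by simpa using h)]
    refine tendsto_const_nhds.congr fun n => ?_
    exact (Real.smoothTransition.zero_of_nonpos
      (mul_nonpos_of_nonneg_of_nonpos n.cast_nonneg (by linarith))).symm

/-- A continuous function with integrable weak derivative `g` is a primitive of `g`. -/
theorem sub_eq_integral_of_weak_deriv {T : ℝ} (hT : 0 < T) {f g : ℝ → ℝ}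
    (hf : ContinuousOn f (Icc 0 T)) (hg : IntegrableOn g (Ioo 0 T))
    (h : ∀ η : ℝ → ℝ, ContDiff ℝ ∞ η → HasCompactSupport η → tsupport η ⊆ Ioo 0 T →
      - ∫ t in Ioo 0 T, f t * deriv η t = ∫ t in Ioo 0 T, g t * η t)
    {s s' : ℝ} (hs : s ∈ Icc 0 T) (hs' : s' ∈ Icc 0 T) :
    f s' - f s = ∫ τ in s..s', g τ := by
  set f' : ℝ → ℝ := IccExtend hT.le ((Icc 0 T).domRestrict f) with hf'
  have hfc : Continuous f' := (continuousOn_iff_continuous_domRestrict.1 hf).Icc_extend'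
  have hfe : ∀ t ∈ Icc 0 T, f' t = f t := fun t ht => by
    rw [hf', IccExtend_of_mem hT.le _ ht]; rfl
  obtain ⟨M, hM⟩ := isCompact_Icc.exists_bound_of_continuousOn hf
  have hM' : ∀ t, |f' t| ≤ M := fun t => hM _ (projIcc 0 T hT.le t).2
  set S := Real.smoothTransition with hS
  have hgi : ∀ a b, a ∈ Icc 0 T → b ∈ Icc 0 T → IntervalIntegrable g volume a b := by
    intro a b ha hb
    have : IntervalIntegrable g volume 0 T := by
      rw [intervalIntegrable_iff_integrableOn_Ioo_of_le hT.le]; exact hg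
    refine this.mono_set ?_
    rw [uIcc_of_le hT.le]
    exact uIcc_subset_Icc ha hb
  have main : ∀ a ∈ Ioo 0 T, ∀ b ∈ Ioo 0 T, a < b → f b - f a = ∫ τ in a..b, g τ := by
    intro a ha b hb hab
    -- Smooth approximation of the indicator of `(a, b]`; its derivative tends to the difference of
    -- point masses at `a` and `b`.
    set η : ℕ → ℝ → ℝ := fun n t => S (n * (t - a)) - S (n * (t - b)) with hη
    have hηd : ∀ n t, deriv (η n) t = n * deriv S (n * (t - a)) - n * deriv S (n * (t - b)) := by
      intro n t
      have hd : ∀ c, HasDerivAt (fun t => S (n * (t - c))) (n * deriv S (n * (t - c))) t := by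
        intro c
        have h1 : HasDerivAt (fun t : ℝ => (n : ℝ) * (t - c)) n t := by
          simpa using ((hasDerivAt_id t).sub_const c).const_mul (n : ℝ)
        have h2 := (Real.smoothTransition.differentiable (n * (t - c))).hasDerivAt.comp t h1
        rw [mul_comm] at h2
        exact h2
      exact ((hd a).sub (hd b)).deriv
    have hηs : ∀ n, ContDiff ℝ ∞ (η n) := fun n => by
      have := Real.smoothTransition.contDiff (n := ⊤)
      refine ContDiff.sub ?_ ?_
      · exact this.comp (contDiff_const.mul (contDiff_id.sub contDiff_const))
      · exact this.comp (contDiff_const.mul (contDiff_id.sub contDiff_const))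
    -- The second step is complete by `b + 1/n`, which is at most the midpoint of `b` and `T` once
    -- `n ≥ 2 / (T - b)`.
    have hsupp : ∀ᶠ n : ℕ in atTop, Function.support (η n) ⊆ Icc a ((b + T) / 2) := by
      filter_upwards [(tendsto_natCast_atTop_atTop (R := ℝ)).eventually_ge_atTop (2 / (T - b)),
        eventually_gt_atTop 0] with n hn hn0 t ht
      by_contra htn
      refine ht ?_
      have hn0' : (0 : ℝ) < n := by exact_mod_cast hn0
      rw [mem_Icc, not_and_or, not_le, not_le] at htn
      simp only [hη]
      rcases htn with htn | htn
      · rw [hS, Real.smoothTransition.zero_of_nonpos, Real.smoothTransition.zero_of_nonpos, sub_zero]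
        · exact mul_nonpos_of_nonneg_of_nonpos hn0'.le (by linarith)
        · exact mul_nonpos_of_nonneg_of_nonpos hn0'.le (by linarith)
      · have hTb : 0 < T - b := by linarith [hb.2]
        rw [div_le_iff₀ hTb] at hn
        rw [hS, Real.smoothTransition.one_of_one_le, Real.smoothTransition.one_of_one_le, sub_self]
        · nlinarith
        · nlinarith
    have hlim1 : Tendsto (fun n => ∫ t in Ioo 0 T, f t * deriv (η n) t) atTop (𝓝 (f a - f b)) := by
      have h1 := (tendsto_integral_smoothTransition_deriv hfc hM' a).sub
        (tendsto_integral_smoothTransition_deriv hfc hM' b)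
      rw [hfe a (Ioo_subset_Icc_self ha), hfe b (Ioo_subset_Icc_self hb)] at h1
      refine h1.congr' ?_
      filter_upwards [hsupp, eventually_gt_atTop 0] with n hn hn0
      have hn0' : (0 : ℝ) < n := by exact_mod_cast hn0
      have hi : ∀ c, Integrable fun t => f' t * (n * deriv S (n * (t - c))) := by
        intro c
        have hc := Real.smoothTransition.continuous_deriv
        refine Continuous.integrable_of_hasCompactSupport (by fun_prop) ?_
        refine HasCompactSupport.mul_left ?_
        refine HasCompactSupport.mul_left ?_
        refine Real.smoothTransition.hasCompactSupport_deriv.comp_homeomorph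
          ((Homeomorph.subRight c).trans (Homeomorph.mulLeft₀ (n : ℝ) hn0'.ne'))
      rw [← integral_sub (hi a) (hi b),
        ← setIntegral_eq_integral_of_forall_compl_eq_zero (s := Ioo 0 T)]
      · refine setIntegral_congr_fun measurableSet_Ioo fun t ht => ?_
        simp only [hηd, ← hfe t (Ioo_subset_Icc_self ht)]
        ring
      · intro t ht
        have : deriv (η n) t = 0 := by
          by_contra hne
          have h2 := closure_minimal hn isClosed_Icc (support_deriv_subset hne)
          exact ht ⟨ha.1.trans_le h2.1, by linarith [h2.2, hb.2]⟩
        rw [← mul_sub, ← hηd, this, mul_zero]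
    have hlim2 : Tendsto (fun n => ∫ t in Ioo 0 T, g t * η n t) atTop
        (𝓝 (∫ t in Ioo 0 T, g t * ((Ioi a).indicator (fun _ => 1) t
          - (Ioi b).indicator (fun _ => 1) t))) := by
      refine tendsto_integral_of_dominated_convergence (fun t => |g t|) (fun n => ?_) hg.abs
        (fun n => .of_forall fun t => ?_) (.of_forall fun t => ?_)
      · exact hg.1.mul (hηs n).continuous.aestronglyMeasurable
      · rw [Real.norm_eq_abs, abs_mul]
        refine mul_le_of_le_one_right (abs_nonneg _) (abs_le.2 ⟨?_, ?_⟩)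
        · linarith [Real.smoothTransition.nonneg (n * (t - a)),
            Real.smoothTransition.le_one (n * (t - b))]
        · linarith [Real.smoothTransition.le_one (n * (t - a)),
            Real.smoothTransition.nonneg (n * (t - b))]
      · exact ((tendsto_smoothTransition_step a t).sub
          (tendsto_smoothTransition_step b t)).const_mul _
    have hlim3 := (hlim1.neg).congr' (f₂ := fun n => ∫ t in Ioo 0 T, g t * η n t) (by
      filter_upwards [hsupp] with n hn
      have h2 : tsupport (η n) ⊆ Icc a ((b + T) / 2) := closure_minimal hn isClosed_Icc
      refine h (η n) (hηs n) (HasCompactSupport.of_support_subset_isCompact isCompact_Icc hn)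
        fun t ht => ⟨ha.1.trans_le (h2 ht).1, by linarith [(h2 ht).2, hb.2]⟩)
    have h3 := tendsto_nhds_unique hlim3 hlim2
    rw [neg_sub] at h3
    rw [h3, intervalIntegral.integral_of_le hab.le, ← integral_indicator measurableSet_Ioo,
      ← integral_indicator measurableSet_Ioc]
    refine integral_congr_ae (.of_forall fun t => ?_)
    by_cases h4 : t ∈ Ioc a b
    · have h5 : t ∈ Ioo 0 T := ⟨ha.1.trans h4.1, h4.2.trans_lt hb.2⟩
      have h6 : ¬ b < t := not_lt.2 h4.2
      simp [h4, h5, h4.1, h6]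
    · by_cases h7 : a < t
      · have h8 : b < t := by
          by_contra h9
          exact h4 ⟨h7, not_lt.1 h9⟩
        by_cases h5 : t ∈ Ioo 0 T <;> simp [h4, h7, h8]
      · have h8 : ¬ b < t := fun h9 => h7 (hab.trans h9)
        by_cases h5 : t ∈ Ioo 0 T <;> simp [h4, h7, h8]
  have h0 : (0 : ℝ) ∈ Icc 0 T := left_mem_Icc.2 hT.le
  -- `Ψ` is constant inside the interval; continuity carries this to the endpoints `0` and `T`,
  -- where no test function lives.
  set Ψ : ℝ → ℝ := fun t => f t - ∫ τ in (0 : ℝ)..t, g τ with hΨ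
  have hΨc : ContinuousOn Ψ (Icc 0 T) := by
    refine hf.sub ?_
    have := intervalIntegral.continuousOn_primitive_interval
      (μ := volume) (f := g) (a := 0) (b := T) (by
        rw [uIcc_of_le hT.le, integrableOn_Icc_iff_integrableOn_Ioo]; exact hg)
    rwa [uIcc_of_le hT.le] at this
  have hΨe : ∀ a ∈ Ioo 0 T, ∀ b ∈ Ioo 0 T, a < b → Ψ a = Ψ b := by
    intro a ha b hb hab
    have h1 := main a ha b hb hab
    have h2 := intervalIntegral.integral_add_adjacent_intervals
      (hgi 0 a h0 (Ioo_subset_Icc_self ha)) (hgi a b (Ioo_subset_Icc_self ha) (Ioo_subset_Icc_self hb))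
    simp only [hΨ]
    linarith
  have hmid : T / 2 ∈ Ioo 0 T := ⟨by linarith, by linarith⟩
  have hΨi : EqOn Ψ (fun _ => Ψ (T / 2)) (Ioo 0 T) := by
    intro a ha
    rcases lt_trichotomy a (T / 2) with h1 | h1 | h1
    · exact hΨe a ha _ hmid h1
    · rw [h1]
    · exact (hΨe _ hmid a ha h1).symm
  have hall := hΨi.of_subset_closure hΨc continuousOn_const Ioo_subset_Icc_self
    (by rw [closure_Ioo hT.ne])
  have h1 : Ψ s' = Ψ s := (hall hs').trans (hall hs).symm
  have h2 := intervalIntegral.integral_add_adjacent_intervals (hgi 0 s h0 hs) (hgi s s' hs hs')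
  simp only [hΨ] at h1
  linarith

/-! ### Integration by parts in `H_N` and `L_N`. -/

namespace NavierStokesVar

variable {N : ℕ} {Ω : Set (E N)}

instance : CompleteSpace (LN Ω) :=
  (Submodule.isClosed_topologicalClosure _).completeSpace_coe

instance : CompleteSpace (VN Ω) :=
  (Submodule.isClosed_topologicalClosure _).completeSpace_coe

instance : Fact ((2 : ENNReal) ≠ ⊤) := ⟨by simp⟩

theorem inner_tensor (a b : E N) (M : Mat N) :
    inner ℝ (tensor a b) M = ∑ i, ∑ j, a i * b j * M (i, j) := by
  rw [PiLp.inner_apply, Fintype.sum_prod_type]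
  simp [tensor, mul_comm]

theorem norm_tensor (a b : E N) : ‖tensor a b‖ = ‖a‖ * ‖b‖ := by
  rw [← sq_eq_sq₀ (norm_nonneg _) (by positivity), mul_pow, EuclideanSpace.real_norm_sq_eq,
    EuclideanSpace.real_norm_sq_eq, EuclideanSpace.real_norm_sq_eq, Fintype.sum_prod_type,
    Finset.sum_mul_sum]
  simp [tensor, mul_pow]

theorem continuous_tensor : Continuous fun p : E N × E N => tensor p.1 p.2 := by
  unfold tensor
  fun_prop

theorem continuous_grad_apply {f : E N → E N} (hf : ContDiff ℝ ∞ f) (p : Fin N × Fin N) :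
    Continuous fun x => grad f x p := by
  have hf' : Continuous (fderiv ℝ f) := hf.continuous_fderiv (by simp)
  have h : Continuous fun x => fderiv ℝ f x (EuclideanSpace.single p.2 (1 : ℝ)) := by fun_prop
  exact (EuclideanSpace.proj p.1 : E N →L[ℝ] ℝ).continuous.comp h

theorem continuous_grad_of_mem_Vcal (φ : Vcal Ω) : Continuous (grad (φ : E N → E N)) := by
  have h1 : Continuous (fderiv ℝ (φ : E N → E N)) := φ.2.1.continuous_fderiv (by simp)
  unfold grad
  fun_prop

theorem hasCompactSupport_grad_of_mem_Vcal (φ : Vcal Ω) :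
    HasCompactSupport (grad (φ : E N → E N)) := by
  refine (φ.2.2.1.fderiv ℝ).mono fun x hx hx' => hx ?_
  ext p
  simp [grad, hx']

theorem fderiv_component {f : E N → E N} {x : E N} (hf : DifferentiableAt ℝ f x) (v : E N)
    (i : Fin N) : fderiv ℝ (fun y => f y i) x v = (fderiv ℝ f x v) i := by
  have h := ((EuclideanSpace.proj i : E N →L[ℝ] ℝ).hasFDerivAt.comp x hf.hasFDerivAt).fderiv
  exact congrArg (fun L => L v) h

/-- The boundary term vanishes because of `f` alone: `θ` is unrestricted near `∂Ω`. This lets the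
formula pass to the closure and be tested with all `θ` on `ℝ^N`. -/
theorem integral_mul_partial {f : E N → E N} (hf : ContDiff ℝ ∞ f) (hfc : HasCompactSupport f)
    (hfs : tsupport f ⊆ Ω) {θ : E N → ℝ} (hθ : ContDiff ℝ ∞ θ) (i j : Fin N) :
    ∫ x in Ω, f x i * fderiv ℝ θ x (EuclideanSpace.single j 1)
      = - ∫ x in Ω, grad f x (i, j) * θ x := by
  have hz : ∀ x ∉ Ω, x ∉ tsupport f := fun x hx h => hx (hfs h)
  have hθ' : Continuous (fderiv ℝ θ) := hθ.continuous_fderiv (by simp)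
  have hc : Continuous (fun x => f x i) := by
    have := hf.continuous
    fun_prop
  have hgc := continuous_grad_apply hf (i, j)
  have hs : HasCompactSupport (fun x => f x i) :=
    hfc.mono fun x hx hx' => hx (by simp only [hx', PiLp.zero_apply])
  have hgs : HasCompactSupport (fun x => grad f x (i, j)) :=
    (hfc.fderiv ℝ).mono fun x hx hx' => hx (by simp [grad, hx'])
  have hd : ∀ x, fderiv ℝ (fun y => f y i) x (EuclideanSpace.single j 1) = grad f x (i, j) :=
    fun x => fderiv_component (hf.differentiable (by simp) x) _ i
  rw [setIntegral_eq_integral_of_forall_compl_eq_zero,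
    setIntegral_eq_integral_of_forall_compl_eq_zero]
  · have h := integral_mul_fderiv_eq_neg_fderiv_mul_of_integrable (μ := (volume : Measure (E N)))
      (f := fun y => f y i) (g := θ) (v := EuclideanSpace.single j 1) ?_ ?_ ?_
      (fun x _ => ?_) (fun x _ => hθ.differentiable (by simp) x)
    · simp_rw [hd] at h
      exact h
    · simp_rw [hd]
      exact (hgc.mul hθ.continuous).integrable_of_hasCompactSupport hgs.mul_right
    · exact Continuous.integrable_of_hasCompactSupport (by fun_prop) hs.mul_right
    · exact (hc.mul hθ.continuous).integrable_of_hasCompactSupport hs.mul_right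
    · have h1 := hf.differentiable (by simp) x
      fun_prop
  · intro x hx
    have : fderiv ℝ f x = 0 := by
      by_contra h
      exact hz x hx (tsupport_fderiv_subset ℝ (subset_tsupport _ h))
    simp [grad, this]
  · intro x hx
    simp [image_eq_zero_of_notMem_tsupport (hz x hx)]

theorem integral_inner_gradient_of_mem_Vcal (φ : Vcal Ω) {θ : E N → ℝ} (hθ : ContDiff ℝ ∞ θ)
    (hs : HasCompactSupport θ) :
    ∫ x in Ω, ∑ j, (φ : E N → E N) x j * fderiv ℝ θ x (EuclideanSpace.single j 1) = 0 := by
  obtain ⟨f, hf, hfc, hfs, hd⟩ := φ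
  have hθ' : Continuous (fderiv ℝ θ) := hθ.continuous_fderiv (by simp)
  have hc := hf.continuous
  have hθc := hθ.continuous
  have i1 : ∀ j, Integrable (fun x => f x j * fderiv ℝ θ x (EuclideanSpace.single j 1))
      (volume.restrict Ω) := fun j => by
    have c1 : Continuous fun x => f x j := by fun_prop
    have c2 : Continuous fun x => fderiv ℝ θ x (EuclideanSpace.single j 1) := by fun_prop
    have s1 : HasCompactSupport fun x => fderiv ℝ θ x (EuclideanSpace.single j 1) :=
      (hs.fderiv ℝ).mono fun x hx hx' => hx (by simp [hx'])
    exact ((c1.mul c2).integrable_of_hasCompactSupport s1.mul_left).restrict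
  have i2 : ∀ j, Integrable (fun x => grad f x (j, j) * θ x) (volume.restrict Ω) := fun j =>
    (((continuous_grad_apply hf (j, j)).mul hθc).integrable_of_hasCompactSupport
      hs.mul_left).restrict
  rw [integral_finsetSum _ fun j _ => i1 j]
  simp_rw [integral_mul_partial hf hfc hfs hθ]
  rw [Finset.sum_neg_distrib, ← integral_finsetSum _ fun j _ => i2 j]
  simp_rw [← Finset.sum_mul]
  have : ∀ x, ∑ i, grad f x (i, i) = 0 := hd
  simp [this]

theorem exists_seq_of_mem_HN {w : L2E Ω} {G : L2M Ω} (h : WithLp.toLp 2 (w, G) ∈ HN Ω) :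
    ∃ φ : ℕ → Vcal Ω, Tendsto (fun n => toL2 Ω (φ n)) atTop (𝓝 w) ∧
      Tendsto (fun n => gradL2 Ω (φ n)) atTop (𝓝 G) := by
  have h' : WithLp.toLp 2 (w, G) ∈ closure ((LinearMap.range
    ((WithLp.linearEquiv 2 ℝ (L2E Ω × L2M Ω)).symm.toLinearMap ∘ₗ
      (toL2 Ω).prod (gradL2 Ω)) : Submodule ℝ _) : Set (WithLp 2 (L2E Ω × L2M Ω))) := h
  obtain ⟨s, hs, hlim⟩ := mem_closure_iff_seq_limit.1 h'
  choose φ hφ using hs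
  have h1 : Tendsto (fun n => WithLp.ofLp (s n)) atTop (𝓝 (w, G)) :=
    ((WithLp.prod_continuous_ofLp 2 (L2E Ω) (L2M Ω)).tendsto _).comp hlim
  have h2 : ∀ n, WithLp.ofLp (s n) = (toL2 Ω (φ n), gradL2 Ω (φ n)) := fun n => by
    rw [← hφ n]; rfl
  simp_rw [h2] at h1
  exact ⟨φ, (continuous_fst.tendsto _).comp h1, (continuous_snd.tendsto _).comp h1⟩

theorem exists_seq_of_mem_LN {w : L2E Ω} (h : w ∈ LN Ω) :
    ∃ φ : ℕ → Vcal Ω, Tendsto (fun n => toL2 Ω (φ n)) atTop (𝓝 w) := by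
  have h' : w ∈ closure (LinearMap.range (toL2 Ω) : Set (L2E Ω)) := h
  obtain ⟨s, hs, hlim⟩ := mem_closure_iff_seq_limit.1 h'
  choose φ hφ using hs
  exact ⟨φ, hlim.congr fun n => (hφ n).symm⟩

theorem snd_mem_VN {w : L2E Ω} {G : L2M Ω} (h : WithLp.toLp 2 (w, G) ∈ HN Ω) : G ∈ VN Ω := by
  obtain ⟨φ, -, h2⟩ := exists_seq_of_mem_HN h
  exact mem_closure_of_tendsto h2 (.of_forall fun n => ⟨φ n, rfl⟩)

theorem toL2_coe (φ : Vcal Ω) : toL2 Ω φ =ᵐ[volume.restrict Ω] (φ : E N → E N) :=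
  (memLp_of_mem_Vcal φ).coeFn_toLp

theorem gradL2_coe (φ : Vcal Ω) : gradL2 Ω φ =ᵐ[volume.restrict Ω] grad (φ : E N → E N) :=
  (memLp_grad_of_mem_Vcal φ).coeFn_toLp

theorem inner_eq_integral_of_ae {F : Type*} [NormedAddCommGroup F] [InnerProductSpace ℝ F]
    {α : Type*} [MeasurableSpace α] {μ : Measure α} {f g : Lp F 2 μ} {f' g' : α → F}
    (hf : f =ᵐ[μ] f') (hg : g =ᵐ[μ] g') :
    (inner ℝ f g : ℝ) = ∫ x, inner ℝ (f' x) (g' x) ∂μ := by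
  rw [L2.inner_def]
  refine integral_congr_ae ?_
  filter_upwards [hf, hg] with x h1 h2
  rw [h1, h2]

/-- Integration by parts for members of `H_N`. -/
theorem integral_mul_partial_of_mem_HN {w : L2E Ω} {G : L2M Ω}
    (h : WithLp.toLp 2 (w, G) ∈ HN Ω) {θ : E N → ℝ} (hθ : ContDiff ℝ ∞ θ)
    (hs : HasCompactSupport θ) (i j : Fin N) :
    ∫ x in Ω, w x i * fderiv ℝ θ x (EuclideanSpace.single j 1)
      = - ∫ x in Ω, G x (i, j) * θ x := by
  obtain ⟨φ, h1, h2⟩ := exists_seq_of_mem_HN h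
  have hθ' : Continuous (fderiv ℝ θ) := hθ.continuous_fderiv (by simp)
  have m1 : MemLp (fun x => fderiv ℝ θ x (EuclideanSpace.single j 1) • EuclideanSpace.single i (1 : ℝ) :
      E N → E N) 2 (volume.restrict Ω) := by
    refine (Continuous.memLp_of_hasCompactSupport ?_ ?_).restrict Ω
    · fun_prop
    · exact (hs.fderiv ℝ).mono fun x hx hx' => hx (by simp [hx'])
  have m2 : MemLp (fun x => θ x • EuclideanSpace.single (i, j) (1 : ℝ) : E N → Mat N) 2
      (volume.restrict Ω) := by
    refine (Continuous.memLp_of_hasCompactSupport ?_ ?_).restrict Ω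
    · exact hθ.continuous.smul continuous_const
    · exact hs.mono fun x hx hx' => hx (by simp [hx'])
  have e1 : ∀ v : L2E Ω, ∀ v' : E N → E N, v =ᵐ[volume.restrict Ω] v' →
      (inner ℝ v (m1.toLp _) : ℝ)
        = ∫ x in Ω, v' x i * fderiv ℝ θ x (EuclideanSpace.single j 1) := by
    intro v v' hv
    rw [inner_eq_integral_of_ae hv m1.coeFn_toLp]
    simp only [EuclideanSpace.inner_single_right, inner_smul_right, one_mul, conj_trivial]
    exact integral_congr_ae (.of_forall fun x => mul_comm _ _)
  have e2 : ∀ v : L2M Ω, ∀ v' : E N → Mat N, v =ᵐ[volume.restrict Ω] v' →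
      (inner ℝ v (m2.toLp _) : ℝ) = ∫ x in Ω, v' x (i, j) * θ x := by
    intro v v' hv
    rw [inner_eq_integral_of_ae hv m2.coeFn_toLp]
    simp only [EuclideanSpace.inner_single_right, inner_smul_right, one_mul, conj_trivial]
    exact integral_congr_ae (.of_forall fun x => mul_comm _ _)
  have l1 := h1.inner (𝕜 := ℝ) (tendsto_const_nhds (x := m1.toLp _))
  have l2 := (h2.inner (𝕜 := ℝ) (tendsto_const_nhds (x := m2.toLp _))).neg
  rw [← e1 w w .rfl, ← e2 G G .rfl]
  refine tendsto_nhds_unique l1 (l2.congr fun n => ?_)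
  rw [e1 _ _ (toL2_coe (φ n)), e2 _ _ (gradL2_coe (φ n)),
    integral_mul_partial (φ n).2.1 (φ n).2.2.1 (φ n).2.2.2.1 hθ]

/-- The gradient is closable: integration by parts against every `θ` determines the second component
from the first. Hence the choice made in `weakGrad` is harmless. -/
theorem eq_zero_of_mem_HN {G : L2M Ω} (h : WithLp.toLp 2 ((0 : L2E Ω), G) ∈ HN Ω) : G = 0 := by
  have h1 : ∀ p : Fin N × Fin N, ∀ᵐ x ∂volume.restrict Ω, G x p = 0 := by
    rintro ⟨i, j⟩
    have hG : MemLp (fun x => G x (i, j)) 2 (volume.restrict Ω) :=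
      (Lp.memLp G).continuousLinearMap_comp
        (EuclideanSpace.proj (i, j) : Mat N →L[ℝ] ℝ)
    refine ae_eq_zero_of_integral_contDiff_smul_eq_zero
      (hG.locallyIntegrable (by norm_num)) fun θ hθ hs => ?_
    have h2 := integral_mul_partial_of_mem_HN h hθ hs i j
    have h3 : ∫ x in Ω, (0 : L2E Ω) x i * fderiv ℝ θ x (EuclideanSpace.single j 1) = 0 := by
      refine integral_eq_zero_of_ae ?_
      filter_upwards [Lp.coeFn_zero (E N) 2 (volume.restrict Ω)] with x hx
      rw [hx]
      simp
    rw [h3, eq_comm, neg_eq_zero] at h2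
    simpa [mul_comm] using h2
  rw [Lp.eq_zero_iff_ae_eq_zero]
  filter_upwards [ae_all_iff.2 h1] with x hx
  ext p
  exact hx p

theorem weakGrad_eq {w : L2E Ω} {G : L2M Ω} (h : WithLp.toLp 2 (w, G) ∈ HN Ω) :
    weakGrad Ω w = G := by
  have hex : ∃ G : L2M Ω, WithLp.toLp 2 (w, G) ∈ HN Ω := ⟨G, h⟩
  rw [weakGrad, dif_pos hex]
  refine sub_eq_zero.1 (eq_zero_of_mem_HN ?_)
  have := (HN Ω).sub_mem hex.choose_spec h
  rwa [← WithLp.toLp_sub, Prod.mk_sub_mk, sub_self] at this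

/-- Members of `L_N` are weakly divergence free. -/
theorem integral_inner_gradient_of_mem_LN {w : L2E Ω} (h : w ∈ LN Ω) {θ : E N → ℝ}
    (hθ : ContDiff ℝ ∞ θ) (hs : HasCompactSupport θ) :
    ∫ x in Ω, ∑ j, w x j * fderiv ℝ θ x (EuclideanSpace.single j 1) = 0 := by
  obtain ⟨φ, h1⟩ := exists_seq_of_mem_LN h
  have hθ' : Continuous (fderiv ℝ θ) := hθ.continuous_fderiv (by simp)
  have m1 : MemLp (fun x => WithLp.toLp 2 fun j => fderiv ℝ θ x (EuclideanSpace.single j 1) :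
      E N → E N) 2 (volume.restrict Ω) := by
    refine (Continuous.memLp_of_hasCompactSupport ?_ ?_).restrict Ω
    · fun_prop
    · refine (hs.fderiv ℝ).mono fun x hx hx' => hx ?_
      ext j
      simp [hx']
  have e1 : ∀ v : L2E Ω, ∀ v' : E N → E N, v =ᵐ[volume.restrict Ω] v' →
      (inner ℝ v (m1.toLp _) : ℝ)
        = ∫ x in Ω, ∑ j, v' x j * fderiv ℝ θ x (EuclideanSpace.single j 1) := by
    intro v v' hv
    rw [inner_eq_integral_of_ae hv m1.coeFn_toLp]
    simp [PiLp.inner_apply, mul_comm]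
  have l1 := h1.inner (𝕜 := ℝ) (tendsto_const_nhds (x := m1.toLp _))
  rw [← e1 w w .rfl]
  refine tendsto_nhds_unique l1 (tendsto_const_nhds.congr fun n => ?_)
  rw [e1 _ _ (toL2_coe (φ n)), integral_inner_gradient_of_mem_Vcal (φ n) hθ hs]

/-! ### The cancellation of the transport term. -/

/-- The truncation `y ↦ y / (1 + |y|² / c²)`, the gradient of `c² / 2 log (1 + |y|² / c²)`. -/
noncomputable def trunc (c : ℝ) (y : E N) : E N := (1 + ‖y‖ ^ 2 / c ^ 2)⁻¹ • y

theorem one_add_sq_div_pos (c : ℝ) (y : E N) : 0 < 1 + ‖y‖ ^ 2 / c ^ 2 := by positivity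

theorem continuous_trunc (c : ℝ) : Continuous (trunc c : E N → E N) := by
  unfold trunc
  exact (Continuous.inv₀ (by fun_prop) fun y => (one_add_sq_div_pos c y).ne').smul continuous_id

theorem norm_trunc_le_self (c : ℝ) (y : E N) : ‖trunc c y‖ ≤ ‖y‖ := by
  rw [trunc, norm_smul, norm_inv, Real.norm_of_nonneg (one_add_sq_div_pos c y).le]
  refine mul_le_of_le_one_left (norm_nonneg _) (inv_le_one_of_one_le₀ ?_)
  linarith [show 0 ≤ ‖y‖ ^ 2 / c ^ 2 by positivity]

theorem norm_trunc_le {c : ℝ} (hc : 0 < c) (y : E N) : ‖trunc c y‖ ≤ c := by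
  rw [trunc, norm_smul, norm_inv, Real.norm_of_nonneg (one_add_sq_div_pos c y).le,
    inv_mul_le_iff₀ (one_add_sq_div_pos c y)]
  have : (1 + ‖y‖ ^ 2 / c ^ 2) * c - ‖y‖ = ((c - ‖y‖ / 2) ^ 2 + 3 / 4 * ‖y‖ ^ 2) / c := by
    field_simp
    ring
  have h2 : 0 ≤ ((c - ‖y‖ / 2) ^ 2 + 3 / 4 * ‖y‖ ^ 2) / c := by positivity
  linarith

theorem tendsto_trunc (y : E N) : Tendsto (fun n : ℕ => trunc ((n : ℝ) + 1) y) atTop (𝓝 y) := by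
  have h1 : Tendsto (fun n : ℕ => ((n : ℝ) + 1) ^ 2) atTop atTop :=
    (tendsto_pow_atTop two_ne_zero).comp
      (tendsto_atTop_add_const_right _ _ tendsto_natCast_atTop_atTop)
  have h2 := ((h1.const_div_atTop (‖y‖ ^ 2)).const_add 1).inv₀ (by simp)
  have h3 := h2.smul_const y
  simpa [trunc] using h3

/-- For smooth divergence free `φ` the truncated transport term of `w ∈ L_N` vanishes. -/
theorem integral_inner_tensor_trunc_eq_zero {w : L2E Ω} (h : w ∈ LN Ω) (φ : Vcal Ω) {c : ℝ}
    (hc : 0 < c) :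
    ∫ x in Ω, (inner ℝ (tensor (trunc c ((φ : E N → E N) x)) (w x)) (grad (φ : E N → E N) x) : ℝ)
      = 0 := by
  have hφ := φ.2.1
  -- With this potential, `∂_j θ = ∑ i, (trunc c φ)_i ∂_j φ_i`, so the integrand equals `w · ∇θ` and
  -- weak divergence freeness of `w` applies.
  set θ : E N → ℝ := fun x => c ^ 2 / 2 * Real.log (1 + ‖(φ : E N → E N) x‖ ^ 2 / c ^ 2) with hθ
  have hθs : ContDiff ℝ ∞ θ := by
    refine contDiff_const.mul (ContDiff.log ?_ fun x => (one_add_sq_div_pos c _).ne')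
    exact contDiff_const.add ((hφ.norm_sq ℝ).div_const _)
  have hθc : HasCompactSupport θ := φ.2.2.1.mono fun x hx hx' => hx (by simp [hθ, hx'])
  rw [← integral_inner_gradient_of_mem_LN h hθs hθc]
  refine integral_congr_ae (.of_forall fun x => ?_)
  have hd : DifferentiableAt ℝ (φ : E N → E N) x := hφ.differentiable (by simp) x
  have hder : HasFDerivAt θ ((c ^ 2 / 2) • ((1 + ‖(φ : E N → E N) x‖ ^ 2 / c ^ 2)⁻¹ •
      ((c ^ 2)⁻¹ • ((2 : ℕ) • (innerSL ℝ ((φ : E N → E N) x)).comp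
        (fderiv ℝ (φ : E N → E N) x))))) x := by
    have h1 := ((hd.hasFDerivAt.norm_sq.const_mul ((c ^ 2)⁻¹)).const_add 1).log
      (by rw [inv_mul_eq_div]; exact (one_add_sq_div_pos c _).ne')
    have h2 := h1.const_mul (c ^ 2 / 2)
    simpa only [inv_mul_eq_div] using h2
  simp only [hder.fderiv, inner_tensor]
  rw [Finset.sum_comm]
  refine Finset.sum_congr rfl fun j _ => ?_
  have h3 : (inner ℝ ((φ : E N → E N) x) (fderiv ℝ (φ : E N → E N) x (EuclideanSpace.single j 1)) : ℝ)
      = ∑ i, (φ : E N → E N) x i * grad (φ : E N → E N) x (i, j) := by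
    rw [PiLp.inner_apply]
    simp [grad, mul_comm]
  simp only [smul_apply, ContinuousLinearMap.comp_apply, innerSL_apply_apply, h3,
    smul_eq_mul, nsmul_eq_mul, trunc, PiLp.smul_apply, Finset.mul_sum]
  refine Finset.sum_congr rfl fun i _ => ?_
  have hc' : c ≠ 0 := hc.ne'
  have hne := (one_add_sq_div_pos c ((φ : E N → E N) x)).ne'
  push_cast
  field_simp

theorem aestronglyMeasurable_tensor {α : Type*} [MeasurableSpace α] {μ : Measure α}
    {f g : α → E N} (hf : AEStronglyMeasurable f μ) (hg : AEStronglyMeasurable g μ) :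
    AEStronglyMeasurable (fun x => tensor (f x) (g x)) μ :=
  continuous_tensor.comp_aestronglyMeasurable (hf.prodMk hg)

theorem abs_inner_tensor_le (a b : E N) (M : Mat N) :
    ‖(inner ℝ (tensor a b) M : ℝ)‖ ≤ ‖a‖ * ‖b‖ * ‖M‖ := by
  rw [← norm_tensor]
  exact norm_inner_le_norm _ _

/-- One sequence of integrals, with `trunc c φ_n ⊗ w` paired with `G`, has two limits. Dominated
convergence along an almost everywhere convergent subsequence gives the desired integral. On the
other hand the identity for `φ_n` lets `G` be replaced by `G - ∇φ_n`, which tends to zero in `L²`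
while the tensor stays bounded by `c‖w‖`. The second bound is where truncation is essential. -/
theorem integral_inner_tensor_trunc_eq_zero_of_mem_HN {w : L2E Ω} {G : L2M Ω} (h : w ∈ LN Ω)
    (hG : WithLp.toLp 2 (w, G) ∈ HN Ω) {c : ℝ} (hc : 0 < c) :
    ∫ x in Ω, (inner ℝ (tensor (trunc c (w x)) (w x)) (G x) : ℝ) = 0 := by
  obtain ⟨φ, h1, h2⟩ := exists_seq_of_mem_HN hG
  obtain ⟨ns, hns, hae⟩ := (tendstoInMeasure_of_tendsto_Lp h1).exists_seq_tendsto_ae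
  have hcoe : ∀ᵐ x ∂volume.restrict Ω, ∀ n, toL2 Ω (φ n) x = (φ n : E N → E N) x :=
    ae_all_iff.2 fun n => toL2_coe (φ n)
  have hwm := (Lp.memLp w)
  have hGm := (Lp.memLp G)
  have hmeas : ∀ n, AEStronglyMeasurable
      (fun x => tensor (trunc c ((φ n : E N → E N) x)) (w x)) (volume.restrict Ω) := fun n =>
    aestronglyMeasurable_tensor
      ((continuous_trunc c).comp (φ n).2.1.continuous).aestronglyMeasurable hwm.1
  have hwG : Integrable (fun x => ‖w x‖ * ‖G x‖) (volume.restrict Ω) :=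
    hwm.norm.integrable_mul hGm.norm
  have lim1 : Tendsto (fun n => ∫ x in Ω,
      (inner ℝ (tensor (trunc c ((φ (ns n) : E N → E N) x)) (w x)) (G x) : ℝ)) atTop
      (𝓝 (∫ x in Ω, (inner ℝ (tensor (trunc c (w x)) (w x)) (G x) : ℝ))) := by
    refine tendsto_integral_of_dominated_convergence (fun x => c * (‖w x‖ * ‖G x‖))
      (fun n => (hmeas _).inner hGm.1) (hwG.const_mul c) (fun n => .of_forall fun x => ?_) ?_
    · refine (abs_inner_tensor_le _ _ _).trans ?_
      rw [mul_assoc]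
      exact mul_le_mul_of_nonneg_right (norm_trunc_le hc _) (by positivity)
    · filter_upwards [hae, hcoe] with x hx1 hx2
      simp only [hx2] at hx1
      have h3 := ((continuous_trunc c).tendsto _).comp hx1
      have h4 := (continuous_tensor.tendsto (trunc c (w x), w x)).comp
        (h3.prodMk_nhds (tendsto_const_nhds (x := w x)))
      exact h4.inner tendsto_const_nhds
  have hmem : ∀ n, MemLp (fun x => tensor (trunc c ((φ n : E N → E N) x)) (w x)) 2
      (volume.restrict Ω) := fun n => by
    refine MemLp.of_le_mul (c := c) hwm (hmeas n) (.of_forall fun x => ?_)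
    rw [norm_tensor]
    exact mul_le_mul_of_nonneg_right (norm_trunc_le hc _) (norm_nonneg _)
  have hnorm : ∀ n, ‖(hmem n).toLp _‖ ≤ c * ‖w‖ := fun n => by
    refine Lp.norm_le_mul_norm_of_ae_le_mul ?_
    filter_upwards [(hmem n).coeFn_toLp] with x hx
    rw [hx, norm_tensor]
    exact mul_le_mul_of_nonneg_right (norm_trunc_le hc _) (norm_nonneg _)
  have heq : ∀ n, ∫ x in Ω, (inner ℝ (tensor (trunc c ((φ n : E N → E N) x)) (w x)) (G x) : ℝ)
      = inner ℝ ((hmem n).toLp _) (G - gradL2 Ω (φ n)) := fun n => by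
    rw [inner_sub_right, inner_eq_integral_of_ae (hmem n).coeFn_toLp (.refl _ G),
      inner_eq_integral_of_ae (hmem n).coeFn_toLp (gradL2_coe (φ n)),
      integral_inner_tensor_trunc_eq_zero h (φ n) hc, sub_zero]
  have lim2 : Tendsto (fun n => ∫ x in Ω,
      (inner ℝ (tensor (trunc c ((φ (ns n) : E N → E N) x)) (w x)) (G x) : ℝ)) atTop (𝓝 0) := by
    have h5 : Tendsto (fun n => c * ‖w‖ * ‖G - gradL2 Ω (φ (ns n))‖) atTop (𝓝 0) := by
      have h6 := ((tendsto_const_nhds (x := G)).sub (h2.comp hns.tendsto_atTop)).norm.const_mul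
        (c * ‖w‖)
      simpa using h6
    refine squeeze_zero_norm (fun n => ?_) h5
    rw [heq]
    exact (norm_inner_le_norm _ _).trans (mul_le_mul_of_nonneg_right (hnorm _) (norm_nonneg _))
  exact tendsto_nhds_unique lim1 lim2

theorem memLp_two_tensor {w : L2E Ω} (hw : MemLp w 4 (volume.restrict Ω)) :
    MemLp (fun x => tensor (w x) (w x)) 2 (volume.restrict Ω) := by
  have h1 : MemLp (fun x => ‖w x‖ * ‖w x‖) 2 (volume.restrict Ω) := by
    have : ENNReal.HolderTriple 4 4 2 := ⟨by
      rw [show (4 : ENNReal) = 2 * 2 by norm_num, ENNReal.mul_inv (by simp) (by simp),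
        ← mul_add, ENNReal.inv_two_add_inv_two, mul_one]⟩
    exact hw.norm.mul hw.norm
  refine h1.mono (aestronglyMeasurable_tensor hw.1 hw.1) (.of_forall fun x => ?_)
  rw [norm_tensor]
  exact le_abs_self _

/-- The cancellation `∫ (w ⊗ w) : ∇w = 0` for divergence free `w ∈ H¹₀ ∩ L⁴`. -/
theorem integral_inner_tensor_self_eq_zero {w : L2E Ω} {G : L2M Ω} (h : w ∈ LN Ω)
    (hG : WithLp.toLp 2 (w, G) ∈ HN Ω) (h4 : MemLp w 4 (volume.restrict Ω)) :
    ∫ x in Ω, (inner ℝ (tensor (w x) (w x)) (G x) : ℝ) = 0 := by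
  have hwm := (Lp.memLp w)
  have hGm := (Lp.memLp G)
  have lim : Tendsto (fun n : ℕ => ∫ x in Ω,
      (inner ℝ (tensor (trunc ((n : ℝ) + 1) (w x)) (w x)) (G x) : ℝ)) atTop
      (𝓝 (∫ x in Ω, (inner ℝ (tensor (w x) (w x)) (G x) : ℝ))) := by
    -- The truncation never exceeds its argument in norm, and `|w|² |G|` is integrable because `w ∈
    -- L⁴`.
    refine tendsto_integral_of_dominated_convergence (fun x => ‖tensor (w x) (w x)‖ * ‖G x‖)
      (fun n => (aestronglyMeasurable_tensor
        ((continuous_trunc _).comp_aestronglyMeasurable hwm.1) hwm.1).inner hGm.1)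
      ((memLp_two_tensor h4).norm.integrable_mul hGm.norm)
      (fun n => .of_forall fun x => ?_) (.of_forall fun x => ?_)
    · rw [norm_tensor]
      refine (abs_inner_tensor_le _ _ _).trans ?_
      gcongr
      exact norm_trunc_le_self _ _
    · have h4 := (continuous_tensor.tendsto (w x, w x)).comp
        ((tendsto_trunc (w x)).prodMk_nhds (tendsto_const_nhds (x := w x)))
      exact h4.inner tendsto_const_nhds
  refine tendsto_nhds_unique lim (tendsto_const_nhds.congr fun n => ?_)
  exact (integral_inner_tensor_trunc_eq_zero_of_mem_HN h hG (by positivity)).symm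

end NavierStokesVar

/-! ### The projected stress, test fields as curves, and existence of `H̄_u`. -/

namespace NavierStokesVar

variable {N : ℕ} {Ω : Set (E N)} {T : ℝ}

instance : IsFiniteMeasure (timeMeasure T) := by
  unfold timeMeasure
  infer_instance

theorem dense_range_toVN : Dense (range (toVN Ω)) := by
  intro x
  rw [closure_subtype]
  have h : (x : L2M Ω) ∈ closure (LinearMap.range (gradL2 Ω) : Set (L2M Ω)) := x.2
  refine closure_mono ?_ h
  rintro _ ⟨φ, rfl⟩
  exact ⟨toVN Ω φ, ⟨φ, rfl⟩, rfl⟩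

theorem eLpNorm_pow_eq_lintegral {α F : Type*} [MeasurableSpace α] {μ : Measure α}
    [NormedAddCommGroup F] {f : α → F} {n : ℕ} (hn : n ≠ 0) :
    eLpNorm f n μ ^ n = ∫⁻ x, ‖f x‖ₑ ^ n ∂μ := by
  have h := eLpNorm_nnreal_pow_eq_lintegral (f := f) (μ := μ) (p := (n : NNReal))
    (by exact_mod_cast hn)
  simpa using h

/-- The orthogonal projection of `w ⊗ w` onto `V_N`; it represents `- div (w ⊗ w)`. -/
noncomputable def stress (w : L2E Ω) : VN Ω :=
  open Classical in
  if h : MemLp (fun x => tensor (w x) (w x)) 2 (volume.restrict Ω) then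
    (VN Ω).orthogonalProjectionOnto (h.toLp _) else 0

theorem inner_stress {w : L2E Ω} (h : MemLp w 4 (volume.restrict Ω)) (g : VN Ω) :
    (inner ℝ (stress w) g : ℝ) = ∫ x in Ω, inner ℝ (tensor (w x) (w x)) ((g : L2M Ω) x) := by
  rw [stress, dif_pos (memLp_two_tensor h), Submodule.inner_orthogonalProjectionOnto_eq_of_mem_right]
  exact inner_eq_integral_of_ae (MemLp.coeFn_toLp _) .rfl

/-- No integrability is needed: outside the `L²` case `stress` takes its default value `0`. -/
theorem enorm_stress_sq_le (w : L2E Ω) :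
    ‖stress w‖ₑ ^ 2 ≤ ∫⁻ x in Ω, ‖w x‖ₑ ^ 4 := by
  rw [stress]
  split_ifs with h
  · have h1 : ‖(VN Ω).orthogonalProjectionOnto (h.toLp _)‖ₑ ≤ ‖h.toLp _‖ₑ := by
      have := Submodule.norm_orthogonalProjectionOnto_apply_le (VN Ω) (h.toLp _)
      rw [← ofReal_norm, ← ofReal_norm]
      exact ENNReal.ofReal_le_ofReal this
    refine (pow_le_pow_left' h1 2).trans ?_
    have h3 := eLpNorm_pow_eq_lintegral (f := fun x => tensor (w x) (w x))
      (μ := volume.restrict Ω) two_ne_zero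
    rw [Nat.cast_ofNat] at h3
    rw [Lp.enorm_toLp, h3]
    refine lintegral_mono fun x => ?_
    have h2 : ‖tensor (w x) (w x)‖ₑ = ‖w x‖ₑ ^ 2 := by
      rw [← ofReal_norm, norm_tensor, ENNReal.ofReal_mul (norm_nonneg _), ofReal_norm, sq]
    rw [h2, ← pow_mul]
  · have h0 : ‖(0 : VN Ω)‖ₑ = 0 := by rw [← ofReal_norm, norm_zero, ENNReal.ofReal_zero]
    rw [h0, zero_pow two_ne_zero]
    exact zero_le

theorem tensor_add_left (a b c : E N) : tensor (a + b) c = tensor a c + tensor b c := by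
  ext p
  simp [tensor, add_mul]

theorem tensor_add_right (a b c : E N) : tensor a (b + c) = tensor a b + tensor a c := by
  ext p
  simp [tensor, mul_add]

theorem tensor_smul_left (r : ℝ) (a b : E N) : tensor (r • a) b = r • tensor a b := by
  ext p
  simp [tensor, mul_assoc]

theorem tensor_smul_right (r : ℝ) (a b : E N) : tensor a (r • b) = r • tensor a b := by
  ext p
  simp [tensor, mul_left_comm]

/-- The form `(v, w) ↦ ∫ (v ⊗ w) : g` is continuous on `L²` for bounded continuous `g`. -/
theorem continuous_integral_inner_tensor {g : E N → Mat N} (hg : Continuous g)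
    (hs : HasCompactSupport g) :
    Continuous fun w : L2E Ω => ∫ x in Ω, (inner ℝ (tensor (w x) (w x)) (g x) : ℝ) := by
  obtain ⟨C, hC⟩ := hs.exists_bound_of_continuous hg
  have hC0 : 0 ≤ C := (norm_nonneg _).trans (hC 0)
  have hb : ∀ v w : L2E Ω, Integrable (fun x => ‖v x‖ * ‖w x‖) (volume.restrict Ω) := fun v w =>
    (Lp.memLp v).norm.integrable_mul (Lp.memLp w).norm
  have hle : ∀ (v w : L2E Ω) x, ‖(inner ℝ (tensor (v x) (w x)) (g x) : ℝ)‖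
      ≤ C * (‖v x‖ * ‖w x‖) := fun v w x =>
    (abs_inner_tensor_le _ _ _).trans (by
      rw [mul_comm C]
      exact mul_le_mul_of_nonneg_left (hC x) (by positivity))
  have hi : ∀ v w : L2E Ω, Integrable (fun x => (inner ℝ (tensor (v x) (w x)) (g x) : ℝ))
      (volume.restrict Ω) := fun v w =>
    ((hb v w).const_mul C).mono' ((aestronglyMeasurable_tensor (Lp.memLp v).1
      (Lp.memLp w).1).inner hg.aestronglyMeasurable) (.of_forall (hle v w))
  let B : L2E Ω →ₗ[ℝ] L2E Ω →ₗ[ℝ] ℝ := LinearMap.mk₂ ℝ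
    (fun v w => ∫ x in Ω, (inner ℝ (tensor (v x) (w x)) (g x) : ℝ))
    (fun v v' w => by
      rw [← integral_add (hi v w) (hi v' w)]
      refine integral_congr_ae ?_
      filter_upwards [Lp.coeFn_add v v'] with x hx
      rw [hx, Pi.add_apply, tensor_add_left, inner_add_left])
    (fun r v w => by
      rw [smul_eq_mul, ← integral_const_mul]
      refine integral_congr_ae ?_
      filter_upwards [Lp.coeFn_smul r v] with x hx
      rw [hx, Pi.smul_apply, tensor_smul_left, real_inner_smul_left])
    (fun v w w' => by
      rw [← integral_add (hi v w) (hi v w')]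
      refine integral_congr_ae ?_
      filter_upwards [Lp.coeFn_add w w'] with x hx
      rw [hx, Pi.add_apply, tensor_add_right, inner_add_left])
    (fun r v w => by
      rw [smul_eq_mul, ← integral_const_mul]
      refine integral_congr_ae ?_
      filter_upwards [Lp.coeFn_smul r w] with x hx
      rw [hx, Pi.smul_apply, tensor_smul_right, real_inner_smul_left])
  have hB : ∀ v w, ‖B v w‖ ≤ C * ‖v‖ * ‖w‖ := by
    intro v w
    have h1 : ‖B v w‖ ≤ ∫ x in Ω, C * (‖v x‖ * ‖w x‖) :=
      norm_integral_le_of_norm_le ((hb v w).const_mul C) (.of_forall (hle v w))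
    have h2 := real_inner_le_norm ((Lp.memLp v).norm.toLp _) ((Lp.memLp w).norm.toLp _)
    rw [inner_eq_integral_of_ae (MemLp.coeFn_toLp _) (MemLp.coeFn_toLp _), Lp.norm_toLp,
      Lp.norm_toLp, eLpNorm_norm, eLpNorm_norm, ← Lp.norm_def, ← Lp.norm_def] at h2
    rw [integral_const_mul] at h1
    rw [mul_assoc]
    refine h1.trans (mul_le_mul_of_nonneg_left (le_trans (le_of_eq ?_) h2) hC0)
    refine integral_congr_ae (.of_forall fun x => ?_)
    simp [mul_comm]
  have hcont := (B.mkContinuous₂ C hB).continuous₂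
  exact hcont.comp (continuous_id.prodMk continuous_id)

/-- Fatou: sublevel sets are closed under convergence in measure. This makes the `L^p` norm Borel on
`L²`, so that norms of a measurable curve in `L²` are measurable in time. -/
theorem lowerSemicontinuous_eLpNorm (p : ENNReal) :
    LowerSemicontinuous fun w : L2E Ω => eLpNorm w p (volume.restrict Ω) := by
  rw [lowerSemicontinuous_iff_isClosed_preimage]
  intro C
  refine IsSeqClosed.isClosed fun s w hs hw => ?_
  exact eLpNorm_le_of_tendstoInMeasure (.of_forall hs) (tendstoInMeasure_of_tendsto_Lp hw)
    fun n => (Lp.memLp _).1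

theorem MemP.ae_memLp_four {u : ℝ → LN Ω} (hu : MemP Ω T u) :
    ∀ᵐ t ∂timeMeasure T, MemLp (u t : L2E Ω) 4 (volume.restrict Ω) := by
  have hm : AEMeasurable (fun t => ∫⁻ x in Ω, ‖(u t : L2E Ω) x‖ₑ ^ 4) (timeMeasure T) := by
    let _ : MeasurableSpace (L2E Ω) := borel _
    have _ : BorelSpace (L2E Ω) := ⟨rfl⟩
    simp_rw [← eLpNorm_pow_eq_lintegral four_ne_zero]
    exact ((lowerSemicontinuous_eLpNorm _).measurable.pow_const 4).comp_aemeasurable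
      (continuous_subtype_val.comp_aestronglyMeasurable hu.memLinfty.1).aemeasurable
  filter_upwards [ae_lt_top' hm hu.memL4.ne] with t ht
  refine ⟨(Lp.memLp _).1, ?_⟩
  rw [eLpNorm_lt_top_iff_lintegral_rpow_enorm_lt_top (by simp) (by simp)]
  simpa using ht

theorem MemP.memLp_stress {u : ℝ → LN Ω} (hu : MemP Ω T u) :
    MemLp (fun t => stress (u t : L2E Ω)) 2 (timeMeasure T) := by
  refine ⟨aestronglyMeasurable_of_inner fun g => ?_, ?_⟩
  -- Measurability is tested on smooth gradients, dense in `V_N`: there the pairing agrees for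
  -- almost every time with a continuous function of `u t ∈ L²`.
  · obtain ⟨s, hs, hlim⟩ := mem_closure_iff_seq_limit.1 (dense_range_toVN g)
    choose φ hφ using hs
    refine aestronglyMeasurable_of_tendsto_ae atTop
      (f := fun n t => (inner ℝ (s n) (stress (u t : L2E Ω)) : ℝ)) (fun n => ?_)
      (.of_forall fun t => hlim.inner tendsto_const_nhds)
    have hc := (continuous_integral_inner_tensor (Ω := Ω) (continuous_grad_of_mem_Vcal (φ n))
      (hasCompactSupport_grad_of_mem_Vcal (φ n))).comp_aestronglyMeasurable
      (continuous_subtype_val.comp_aestronglyMeasurable hu.memLinfty.1)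
    refine hc.congr ?_
    filter_upwards [hu.ae_memLp_four] with t ht
    rw [← hφ n, real_inner_comm, inner_stress ht]
    refine integral_congr_ae ?_
    filter_upwards [gradL2_coe (φ n)] with x hx
    rw [← hx]
    rfl
  · rw [eLpNorm_lt_top_iff_lintegral_rpow_enorm_lt_top (by simp) (by simp)]
    refine lt_of_le_of_lt (lintegral_mono fun t => ?_) hu.memL4
    simpa using enorm_stress_sq_le (u t : L2E Ω)

theorem inner_stress_weakGrad_eq_zero {w : L2E Ω} (h : w ∈ LN Ω) (g : VN Ω)
    (hg : WithLp.toLp 2 (w, (g : L2M Ω)) ∈ HN Ω) (h4 : MemLp w 4 (volume.restrict Ω)) :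
    (inner ℝ (stress w) g : ℝ) = 0 := by
  rw [inner_stress h4]
  exact integral_inner_tensor_self_eq_zero h hg h4

/-- The time slices of a continuous function with compact support, as a curve in `L²(Ω)`, are
square integrable in time. -/
theorem memLp_slices {ι : Type*} [Fintype ι] {f : ℝ × E N → EuclideanSpace ℝ ι}
    (hf : Continuous f) (hs : HasCompactSupport f)
    {c : ℝ → Lp (EuclideanSpace ℝ ι) 2 (volume.restrict Ω)}
    (hc : ∀ t, c t =ᵐ[volume.restrict Ω] fun x => f (t, x)) :
    MemLp c 2 (timeMeasure T) := by
  have hm : AEStronglyMeasurable c (timeMeasure T) := by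
    refine aestronglyMeasurable_of_inner fun g => ?_
    have h1 : ∀ t, (inner ℝ g (c t) : ℝ) = ∫ x in Ω, inner ℝ (g x) (f (t, x)) := fun t =>
      inner_eq_integral_of_ae .rfl (hc t)
    simp_rw [h1]
    have h2 : StronglyMeasurable fun p : ℝ × E N => (inner ℝ (g p.2) (f p) : ℝ) :=
      ((Lp.stronglyMeasurable g).comp_measurable measurable_snd).inner hf.stronglyMeasurable
    exact (h2.integral_prod_right' (ν := volume.restrict Ω)).aestronglyMeasurable
  rw [memLp_two_iff_integrable_sq_norm hm]
  have h3 : ∀ t, ‖c t‖ ^ 2 = ∫ x in Ω, ‖f (t, x)‖ ^ 2 := fun t => by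
    rw [← real_inner_self_eq_norm_sq, inner_eq_integral_of_ae (hc t) (hc t)]
    simp_rw [real_inner_self_eq_norm_sq]
  simp_rw [h3]
  have h4 : Integrable (fun p : ℝ × E N => ‖f p‖ ^ 2) (volume : Measure (ℝ × E N)) := by
    refine Continuous.integrable_of_hasCompactSupport (by fun_prop) ?_
    exact hs.mono fun x hx hx' => hx (by simp [hx'])
  have h5 : Integrable (fun p : ℝ × E N => ‖f p‖ ^ 2)
      ((timeMeasure T).prod (volume.restrict Ω)) := by
    rw [timeMeasure, Measure.prod_restrict, ← Measure.volume_eq_prod]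
    exact h4.restrict
  exact h5.integral_prod_left

namespace TestField

variable (ψ : TestField Ω T)

theorem dt_eq (t : ℝ) (x : E N) : ψ.dt t x = fderiv ℝ ψ.toFun (t, x) (1, 0) := by
  have h1 : HasDerivAt (fun s : ℝ => (s, x)) ((1 : ℝ), (0 : E N)) t :=
    (hasDerivAt_id t).prodMk (hasDerivAt_const t x)
  exact (((ψ.smooth.differentiable (by simp)) (t, x)).hasFDerivAt.comp_hasDerivAt t h1).deriv

theorem dx_apply (t : ℝ) (x : E N) (p : Fin N × Fin N) :
    ψ.dx t x p = (fderiv ℝ ψ.toFun (t, x) (0, EuclideanSpace.single p.2 1)) p.1 := by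
  have h1 := ((ψ.smooth.differentiable (by simp)) (t, x)).hasFDerivAt.comp x
    (hasFDerivAt_prodMk_right t x)
  have h2 : fderiv ℝ (fun y => ψ.toFun (t, y)) x
      = (fderiv ℝ ψ.toFun (t, x)).comp (ContinuousLinearMap.inr ℝ ℝ (E N)) := h1.fderiv
  simp [dx, grad, h2]

theorem continuous_dt : Continuous fun p : ℝ × E N => ψ.dt p.1 p.2 := by
  have := ψ.smooth.continuous_fderiv (by simp)
  simp only [dt_eq]
  fun_prop

theorem continuous_dx : Continuous fun p : ℝ × E N => ψ.dx p.1 p.2 := by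
  have h := ψ.smooth.continuous_fderiv (by simp)
  rw [← (PiLp.homeomorph 2 _).comp_continuous_iff]
  refine continuous_pi fun q => ?_
  have h2 : Continuous fun p : ℝ × E N =>
      fderiv ℝ ψ.toFun p (0, EuclideanSpace.single q.2 1) := by fun_prop
  have h3 := (EuclideanSpace.proj q.1 : E N →L[ℝ] ℝ).continuous.comp h2
  refine h3.congr fun p => ?_
  exact (ψ.dx_apply p.1 p.2 q).symm

theorem hasCompactSupport_dt : HasCompactSupport fun p : ℝ × E N => ψ.dt p.1 p.2 :=
  (ψ.compact.fderiv ℝ).mono fun p hp hp' => hp (by simp only [dt_eq, hp']; rfl)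

theorem hasCompactSupport_dx : HasCompactSupport fun p : ℝ × E N => ψ.dx p.1 p.2 :=
  (ψ.compact.fderiv ℝ).mono fun p hp hp' => hp (by ext q; simp only [dx_apply, hp']; rfl)

theorem memLp_dt (t : ℝ) : MemLp (ψ.dt t) 2 (volume.restrict Ω) := by
  have h1 : Continuous (ψ.dt t) := ψ.continuous_dt.comp (Continuous.prodMk_right t)
  have h2 : HasCompactSupport (ψ.dt t) := by
    refine HasCompactSupport.of_support_subset_isCompact
      (ψ.hasCompactSupport_dt.isCompact.image continuous_snd) fun x hx => ?_
    exact ⟨(t, x), subset_tsupport _ hx, rfl⟩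
  exact (h1.memLp_of_hasCompactSupport h2).restrict Ω

/-- The class of `∂_t ψ(t, ·)` in `L²(Ω, ℝ^N)`. -/
noncomputable def dtL2 (t : ℝ) : L2E Ω := (ψ.memLp_dt t).toLp _

theorem memLp_dtL2 : MemLp ψ.dtL2 2 (timeMeasure T) :=
  memLp_slices ψ.continuous_dt ψ.hasCompactSupport_dt fun t => (ψ.memLp_dt t).coeFn_toLp

theorem memLp_toVN_slice : MemLp (fun t => toVN Ω (ψ.slice t)) 2 (timeMeasure T) := by
  have h : MemLp (fun t => gradL2 Ω (ψ.slice t)) 2 (timeMeasure T) :=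
    memLp_slices ψ.continuous_dx ψ.hasCompactSupport_dx fun t => gradL2_coe (ψ.slice t)
  refine MemLp.of_le h ?_ (.of_forall fun t => le_rfl)
  rw [← Topology.IsEmbedding.subtypeVal.aestronglyMeasurable_comp_iff]
  exact h.1

theorem integral_inner_dt (w : L2E Ω) (t : ℝ) :
    ∫ x in Ω, (inner ℝ (w x) (ψ.dt t x) : ℝ) = inner ℝ w (ψ.dtL2 t) :=
  (inner_eq_integral_of_ae .rfl (ψ.memLp_dt t).coeFn_toLp).symm

theorem integral_inner_dx (g : VN Ω) (t : ℝ) :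
    ∫ x in Ω, (inner ℝ ((g : L2M Ω) x) (ψ.dx t x) : ℝ) = inner ℝ g (toVN Ω (ψ.slice t)) :=
  (inner_eq_integral_of_ae .rfl (gradL2_coe (ψ.slice t))).symm

end TestField

theorem integrable_inner_of_memLp {α X : Type*} [MeasurableSpace α] {μ : Measure α}
    [NormedAddCommGroup X] [InnerProductSpace ℝ X] {f g : α → X} (hf : MemLp f 2 μ)
    (hg : MemLp g 2 μ) : Integrable (fun a => (inner ℝ (f a) (g a) : ℝ)) μ := by
  refine (hf.norm.integrable_mul hg.norm).mono' (hf.1.inner hg.1) (.of_forall fun a => ?_)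
  exact norm_inner_le_norm _ _

theorem MemP.memLp_two {u : ℝ → LN Ω} (hu : MemP Ω T u) :
    MemLp (fun t => (u t : L2E Ω)) 2 (timeMeasure T) :=
  (hu.memLinfty.mono_exponent le_top).continuousLinearMap_comp (LN Ω).subtypeL

theorem MemP.evolutionForm_eq {u : ℝ → LN Ω} (hu : MemP Ω T u) (ψ : TestField Ω T) :
    evolutionForm u ψ = (∫ t, inner ℝ (u t : L2E Ω) (ψ.dtL2 t) ∂timeMeasure T)
      + ∫ t, inner ℝ (stress (u t : L2E Ω)) (toVN Ω (ψ.slice t)) ∂timeMeasure T := by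
  rw [evolutionForm, ← integral_add (integrable_inner_of_memLp hu.memLp_two ψ.memLp_dtL2)
    (integrable_inner_of_memLp hu.memLp_stress ψ.memLp_toVN_slice)]
  refine integral_congr_ae ?_
  filter_upwards [hu.ae_memLp_four] with t ht
  have hg : (toVN Ω (ψ.slice t) : L2M Ω) =ᵐ[volume.restrict Ω] ψ.dx t := gradL2_coe (ψ.slice t)
  have hg2 : MemLp (ψ.dx t) 2 (volume.restrict Ω) := memLp_grad_of_mem_Vcal (ψ.slice t)
  rw [integral_add (integrable_inner_of_memLp (Lp.memLp _) (ψ.memLp_dt t))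
    (integrable_inner_of_memLp (memLp_two_tensor ht) hg2), ψ.integral_inner_dt, inner_stress ht]
  congr 1
  refine integral_congr_ae ?_
  filter_upwards [hg] with x hx
  rw [hx]

/-- Both terms of the evolution form are functionals on `V_N`. The Riesz isometry represents `∂_t
u`, and `stress` represents the quadratic term. -/
theorem MemP.exists_isHbar {u : ℝ → LN Ω} (hu : MemP Ω T u) : ∃ H, IsHbar Ω T u H := by
  obtain ⟨v, hv, hvψ⟩ := hu.timeDeriv
  have hR : MemLp (fun t => (InnerProductSpace.toDual ℝ (VN Ω)).symm (v t)) 2 (timeMeasure T) :=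
    (LipschitzWith.comp_memLp
      (InnerProductSpace.toDual ℝ (VN Ω)).symm.lipschitz (LinearIsometryEquiv.map_zero _) hv)
  refine ⟨fun t => stress (u t : L2E Ω) - (InnerProductSpace.toDual ℝ (VN Ω)).symm (v t),
    hu.memLp_stress.sub hR, fun ψ => ?_⟩
  have h1 := hvψ ψ
  simp only [ψ.integral_inner_dt] at h1
  change -(∫ t, _ ∂timeMeasure T) = ∫ t, _ ∂timeMeasure T at h1
  simp only [ψ.integral_inner_dx, inner_sub_left, InnerProductSpace.toDual_symm_apply]
  have h2 := integrable_inner_of_memLp hR ψ.memLp_toVN_slice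
  simp only [InnerProductSpace.toDual_symm_apply] at h2
  change _ = ∫ t, _ ∂timeMeasure T
  rw [hu.evolutionForm_eq, integral_sub (integrable_inner_of_memLp hu.memLp_stress
    ψ.memLp_toVN_slice) h2, ← h1]
  ring

theorem MemP.isHbar_Hbar {u : ℝ → LN Ω} (hu : MemP Ω T u) : IsHbar Ω T u (Hbar Ω T u) := by
  rw [Hbar, dif_pos hu.exists_isHbar]
  exact hu.exists_isHbar.choose_spec

end NavierStokesVar

/-! ### The energy identity on `𝒫` and the completed square. -/

namespace NavierStokesVar

variable {N : ℕ} {Ω : Set (E N)} {T : ℝ}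

theorem grad_const_smul (c : ℝ) {f : E N → E N} (hf : ContDiff ℝ ∞ f) (x : E N) :
    grad (fun y => c • f y) x = c • grad f x :=
  congrFun (grad_smul c hf) x

/-- The test field `(t, x) ↦ η(t) φ(x)`. -/
def TestField.ofProd {η : ℝ → ℝ} (hη : ContDiff ℝ ∞ η) (hc : HasCompactSupport η)
    (hs : tsupport η ⊆ Ioo 0 T) (φ : Vcal Ω) : TestField Ω T where
  toFun p := η p.1 • (φ : E N → E N) p.2
  smooth := (hη.comp contDiff_fst).smul (φ.2.1.comp contDiff_snd)
  compact := by
    refine HasCompactSupport.of_support_subset_isCompact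
      (hc.isCompact.prod φ.2.2.1.isCompact) fun p hp => ⟨?_, ?_⟩
    · exact subset_tsupport _ fun h => hp (by simp [h])
    · exact subset_tsupport _ fun h => hp (by simp [h])
  supp := by
    refine (closure_minimal (t := tsupport η ×ˢ tsupport (φ : E N → E N)) ?_
      ((isClosed_tsupport _).prod (isClosed_tsupport _))).trans
      (prod_mono hs φ.2.2.2.1)
    refine fun p hp => ⟨?_, ?_⟩
    · exact subset_tsupport _ fun h => hp (by simp [h])
    · exact subset_tsupport _ fun h => hp (by simp [h])
  divFree t x := by
    have h : ∑ i, grad (φ : E N → E N) x (i, i) = 0 := φ.2.2.2.2 x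
    simp only [div, grad_const_smul _ φ.2.1, PiLp.smul_apply, smul_eq_mul, ← Finset.mul_sum, h,
      mul_zero]

section

variable {η : ℝ → ℝ} (hη : ContDiff ℝ ∞ η) (hc : HasCompactSupport η)
  (hs : tsupport η ⊆ Ioo 0 T) (φ : Vcal Ω)

theorem TestField.toVN_ofProd_slice (t : ℝ) :
    toVN Ω ((TestField.ofProd hη hc hs φ).slice t) = η t • toVN Ω φ := by
  have h : (TestField.ofProd hη hc hs φ).slice t = η t • φ := Subtype.ext rfl
  rw [h]
  exact Subtype.ext ((gradL2 Ω).map_smul _ _)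

theorem TestField.inner_toVN_ofProd_slice (g : VN Ω) (t : ℝ) :
    (inner ℝ g (toVN Ω ((TestField.ofProd hη hc hs φ).slice t)) : ℝ)
      = η t * inner ℝ g (toVN Ω φ) := by
  rw [TestField.toVN_ofProd_slice]
  exact real_inner_smul_right g (toVN Ω φ) (η t)

theorem TestField.dtL2_ofProd (t : ℝ) :
    (TestField.ofProd hη hc hs φ).dtL2 t = deriv η t • toL2 Ω φ := by
  have h : (TestField.ofProd hη hc hs φ).dt t = deriv η t • (φ : E N → E N) := by
    funext x
    exact deriv_smul_const (hη.differentiable (by simp) t) ((φ : E N → E N) x)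
  refine Lp.ext ?_
  filter_upwards [((TestField.ofProd hη hc hs φ).memLp_dt t).coeFn_toLp, toL2_coe φ,
    Lp.coeFn_smul (deriv η t) (toL2 Ω φ)] with x h1 h2 h3
  rw [TestField.dtL2, h1, h, h3, Pi.smul_apply, Pi.smul_apply, h2]

end

theorem tendsto_toVN {φ : ℕ → Vcal Ω} {g : VN Ω}
    (h : Tendsto (fun n => gradL2 Ω (φ n)) atTop (𝓝 (g : L2M Ω))) :
    Tendsto (fun n => toVN Ω (φ n)) atTop (𝓝 g) :=
  tendsto_subtype_rng.2 h

theorem intervalIntegrable_of_memLp_two {X : Type*} [NormedAddCommGroup X] (hT : 0 < T)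
    {F : ℝ → X} (hF : MemLp F 2 (timeMeasure T)) {s s' : ℝ} (hs : s ∈ Icc 0 T)
    (hs' : s' ∈ Icc 0 T) : IntervalIntegrable F volume s s' := by
  have : IntervalIntegrable F volume 0 T := by
    rw [intervalIntegrable_iff_integrableOn_Ioo_of_le hT.le]
    exact hF.integrable (by norm_num)
  refine this.mono_set ?_
  rw [uIcc_of_le hT.le]
  exact uIcc_subset_Icc hs hs'

theorem intervalIntegral_inner_const {X : Type*} [NormedAddCommGroup X] [InnerProductSpace ℝ X]
    [CompleteSpace X] {F : ℝ → X} {s s' : ℝ} (hF : IntervalIntegrable F volume s s') (g : X) :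
    ∫ τ in s..s', (inner ℝ (F τ) g : ℝ) = inner ℝ (∫ τ in s..s', F τ) g := by
  have := (innerSL ℝ g).intervalIntegral_comp_comm hF
  simpa [real_inner_comm] using this

/-- Product test fields `η(t) φ(x)` identify the weak derivative of `t ↦ ⟨u t, φ⟩`; weak continuity
turns this into increments between any two times. -/
theorem inner_sub_eq_integral_of_mem_Vcal (hT : 0 < T) {u : ℝ → LN Ω} (hu : MemP Ω T u)
    {H : ℝ → VN Ω} (hH : IsHbar Ω T u H) (φ : Vcal Ω) {s s' : ℝ} (hs : s ∈ Icc 0 T)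
    (hs' : s' ∈ Icc 0 T) :
    (inner ℝ (u s' - u s : L2E Ω) (toL2 Ω φ) : ℝ)
      = ∫ τ in s..s', inner ℝ (stress (u τ : L2E Ω) - H τ) (toVN Ω φ) := by
  have hcont : ContinuousOn (fun t => (inner ℝ (u t : L2E Ω) (toL2 Ω φ) : ℝ)) (Icc 0 T) :=
    hu.weakCont ⟨toL2 Ω φ, Submodule.le_topologicalClosure _ ⟨φ, rfl⟩⟩
  have hF := hu.memLp_stress.sub hH.1
  have hg : MemLp (fun _ : ℝ => toVN Ω φ) 2 (timeMeasure T) := memLp_const _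
  rw [inner_sub_left]
  refine sub_eq_integral_of_weak_deriv hT hcont (integrable_inner_of_memLp hF hg)
    (fun η hη hc hsupp => ?_) hs hs'
  have h1 := hH.2 (TestField.ofProd hη hc hsupp φ)
  have h2 := (integrable_inner_of_memLp hu.memLp_stress
    (TestField.ofProd hη hc hsupp φ).memLp_toVN_slice)
  have h3 := (integrable_inner_of_memLp hH.1
    (TestField.ofProd hη hc hsupp φ).memLp_toVN_slice)
  rw [hu.evolutionForm_eq] at h1
  simp only [TestField.integral_inner_dx] at h1
  simp only [TestField.inner_toVN_ofProd_slice, TestField.dtL2_ofProd, real_inner_smul_right]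
    at h1 h2 h3
  have h4 := integral_sub h2 h3
  change - (∫ t, _ ∂timeMeasure T) = ∫ t, _ ∂timeMeasure T
  change _ + _ = ∫ t, _ ∂timeMeasure T at h1
  have h5 : ∀ t, (inner ℝ (stress (u t : L2E Ω) - H t) (toVN Ω φ) : ℝ) * η t
      = η t * inner ℝ (stress (u t : L2E Ω)) (toVN Ω φ) - η t * inner ℝ (H t) (toVN Ω φ) := by
    intro t
    rw [inner_sub_left]
    ring
  simp only [Pi.sub_apply, h5, h4, mul_comm _ (deriv η _)]
  linarith

/-- The left side is continuous in the `L²` norm of the test function, the right in the norm of its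
gradient; convergence in `H_N` controls both. This makes `u t` admissible as a test function for
almost every `t`. -/
theorem inner_sub_eq_integral_of_mem_HN (hT : 0 < T) {u : ℝ → LN Ω} (hu : MemP Ω T u)
    {H : ℝ → VN Ω} (hH : IsHbar Ω T u H) {w : L2E Ω} {g : VN Ω}
    (hw : WithLp.toLp 2 (w, (g : L2M Ω)) ∈ HN Ω) {s s' : ℝ} (hs : s ∈ Icc 0 T)
    (hs' : s' ∈ Icc 0 T) :
    (inner ℝ (u s' - u s : L2E Ω) w : ℝ)
      = ∫ τ in s..s', inner ℝ (stress (u τ : L2E Ω) - H τ) g := by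
  obtain ⟨φ, h1, h2⟩ := exists_seq_of_mem_HN hw
  have hF : IntervalIntegrable (fun τ => stress (u τ : L2E Ω) - H τ) volume s s' :=
    intervalIntegrable_of_memLp_two hT (hu.memLp_stress.sub hH.1) hs hs'
  have l1 := (tendsto_const_nhds (x := (u s' - u s : L2E Ω))).inner (𝕜 := ℝ) h1
  have l2 := (tendsto_const_nhds (x := ∫ τ in s..s', (stress (u τ : L2E Ω) - H τ))).inner (𝕜 := ℝ)
    (tendsto_toVN h2)
  rw [intervalIntegral_inner_const hF]
  refine tendsto_nhds_unique l1 (l2.congr fun n => ?_)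
  rw [inner_sub_eq_integral_of_mem_Vcal hT hu hH (φ n) hs hs', intervalIntegral_inner_const hF]

/-- The curve of weak gradients of a member of `ℛ'`, as a curve in `V_N`. -/
theorem MemR.exists_grad {u : ℝ → LN Ω} (hu : MemR Ω T u) :
    ∃ G : ℝ → VN Ω, MemLp G 2 (timeMeasure T) ∧ ∀ᵐ t ∂timeMeasure T,
      WithLp.toLp 2 ((u t : L2E Ω), (G t : L2M Ω)) ∈ HN Ω := by
  obtain ⟨U, hU, hUu⟩ := hu.memHN
  have hmem : ∀ p : HN Ω, WithLp.toLp 2 ((p : WithLp 2 (L2E Ω × L2M Ω)).fst,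
      (p : WithLp 2 (L2E Ω × L2M Ω)).snd) ∈ HN Ω := fun p => p.2
  refine ⟨fun t => ⟨(U t : WithLp 2 (L2E Ω × L2M Ω)).snd, snd_mem_VN (hmem (U t))⟩, ?_, ?_⟩
  · have h : MemLp (fun t => (U t : WithLp 2 (L2E Ω × L2M Ω)).snd) 2 (timeMeasure T) :=
      hU.continuousLinearMap_comp ((WithLp.sndL 2 ℝ (L2E Ω) (L2M Ω)).comp (HN Ω).subtypeL)
    refine MemLp.of_le h ?_ (.of_forall fun t => le_rfl)
    rw [← Topology.IsEmbedding.subtypeVal.aestronglyMeasurable_comp_iff]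
    exact h.1
  · filter_upwards [hUu] with t ht
    rw [← ht]
    exact hmem (U t)

/-- The energy identity for members of `𝒫`. -/
theorem MemP.energy {u : ℝ → LN Ω} (hT : 0 < T) (hu : MemP Ω T u) {H : ℝ → VN Ω}
    (hH : IsHbar Ω T u H) {G : ℝ → VN Ω} (hG : MemLp G 2 (timeMeasure T))
    (hGu : ∀ᵐ t ∂timeMeasure T, WithLp.toLp 2 ((u t : L2E Ω), (G t : L2M Ω)) ∈ HN Ω) :
    ‖u T‖ ^ 2 + 2 * ∫ t, inner ℝ (H t) (G t) ∂timeMeasure T = ‖u 0‖ ^ 2 := by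
  have h1 := energy_identity hT hu.weakCont (hu.memLp_stress.sub hH.1) hG (by
    filter_upwards [hGu] with t ht s hs s' hs'
    exact inner_sub_eq_integral_of_mem_HN hT hu hH ht hs hs')
  change _ = 2 * ∫ t, _ ∂timeMeasure T at h1
  -- The stress drops out by the cancellation, leaving only `H` in the energy balance.
  have h2 : ∫ t, (inner ℝ (stress (u t : L2E Ω) - H t) (G t) : ℝ) ∂timeMeasure T
      = - ∫ t, inner ℝ (H t) (G t) ∂timeMeasure T := by
    rw [← integral_neg]
    refine integral_congr_ae ?_
    filter_upwards [hGu, hu.ae_memLp_four] with t ht h4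
    rw [inner_sub_left, inner_stress_weakGrad_eq_zero (u t).2 _ ht h4, zero_sub]
  simp only [Pi.sub_apply] at h1
  rw [h2] at h1
  linarith

/-- Completing the square: `J_r` measures the distance of `H̄_u` to `∇u + ∇r`. -/
theorem MemP.J_eq {u : ℝ → LN Ω} (hT : 0 < T) (hu : MemP Ω T u) {r : ℝ → VN Ω}
    (hr : MemLp r 2 (timeMeasure T)) {G : ℝ → VN Ω} (hG : MemLp G 2 (timeMeasure T))
    (hGu : ∀ᵐ t ∂timeMeasure T, WithLp.toLp 2 ((u t : L2E Ω), (G t : L2M Ω)) ∈ HN Ω) :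
    J Ω T r u = 1 / 2 * (∫ t, ‖G t + r t - Hbar Ω T u t‖ ^ 2 ∂timeMeasure T
      + ∫ t, ‖r t‖ ^ 2 ∂timeMeasure T + ‖u 0‖ ^ 2) := by
  have hH := hu.isHbar_Hbar
  have i1 : Integrable (fun t => ‖G t + r t - Hbar Ω T u t‖ ^ 2) (timeMeasure T) :=
    ((hG.add hr).sub hH.1).integrable_norm_pow two_ne_zero
  have i2 : Integrable (fun t => ‖r t‖ ^ 2) (timeMeasure T) := hr.integrable_norm_pow two_ne_zero
  have i12 : Integrable (fun t => ‖G t + r t - Hbar Ω T u t‖ ^ 2 + ‖r t‖ ^ 2) (timeMeasure T) :=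
    i1.add i2
  have i3 := integrable_inner_of_memLp hH.1 hG
  have h1 : ∫ t, (‖weakGrad Ω (u t : L2E Ω) + (r t : L2M Ω)‖ ^ 2
        + ‖(Hbar Ω T u t : L2M Ω) - (r t : L2M Ω)‖ ^ 2) ∂timeMeasure T
      = ∫ t, ‖G t + r t - Hbar Ω T u t‖ ^ 2 ∂timeMeasure T
        + ∫ t, ‖r t‖ ^ 2 ∂timeMeasure T + 2 * ∫ t, inner ℝ (Hbar Ω T u t) (G t) ∂timeMeasure T := by
    rw [← integral_const_mul, ← integral_add i1 i2, ← integral_add i12 (i3.const_mul 2)]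
    refine integral_congr_ae ?_
    filter_upwards [hGu] with t ht
    rw [weakGrad_eq ht]
    -- The cross terms `2⟨G + r, H⟩` and `-2⟨H, r⟩` combine to `2⟨H, G⟩`.
    change ‖G t + r t‖ ^ 2 + ‖Hbar Ω T u t - r t‖ ^ 2 = _
    rw [norm_sub_sq_real (G t + r t), norm_sub_sq_real, inner_add_left,
      real_inner_comm (Hbar Ω T u t) (G t), real_inner_comm (r t) (Hbar Ω T u t)]
    ring
  have h2 := hu.energy hT hH hG hGu
  rw [J]
  change 1 / 2 * ((∫ t, _ ∂timeMeasure T) + _) = _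
  rw [h1, ← h2]
  ring

/-- Two representatives of `∂_t u + div (u ⊗ u)` agree at almost every time. -/
theorem IsHbar.ae_eq {u : ℝ → LN Ω} {H H' : ℝ → VN Ω} (hH : IsHbar Ω T u H)
    (hH' : IsHbar Ω T u H') : H =ᵐ[timeMeasure T] H' := by
  have hsub := hH.1.sub hH'.1
  have h1 : ∀ φ : Vcal Ω, ∀ᵐ t ∂timeMeasure T, (inner ℝ (H t - H' t) (toVN Ω φ) : ℝ) = 0 := by
    intro φ
    have hg : MemLp (fun _ : ℝ => toVN Ω φ) 2 (timeMeasure T) := memLp_const _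
    have hi : IntegrableOn (fun t => (inner ℝ (H t - H' t) (toVN Ω φ) : ℝ)) (Ioo 0 T) :=
      integrable_inner_of_memLp hsub hg
    have := isOpen_Ioo.ae_eq_zero_of_integral_contDiff_smul_eq_zero hi.locallyIntegrableOn
      fun η hη hc hs => by
        have e1 := (hH.2 (TestField.ofProd hη hc hs φ)).symm.trans
          (hH'.2 (TestField.ofProd hη hc hs φ))
        have e2 := (integrable_inner_of_memLp hH.1
          (TestField.ofProd hη hc hs φ).memLp_toVN_slice)
        have e3 := (integrable_inner_of_memLp hH'.1
          (TestField.ofProd hη hc hs φ).memLp_toVN_slice)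
        simp only [TestField.integral_inner_dx] at e1
        simp only [TestField.inner_toVN_ofProd_slice] at e1 e2 e3
        have e4 := integral_sub e2 e3
        rw [← setIntegral_eq_integral_of_forall_compl_eq_zero (s := Ioo 0 T)]
        · change ∫ t, _ ∂timeMeasure T = 0
          simp only [smul_eq_mul, inner_sub_left, mul_sub]
          rw [e4, sub_eq_zero]
          exact e1
        · intro t ht
          rw [image_eq_zero_of_notMem_tsupport fun h => ht (hs h), zero_smul]
    rwa [← ae_restrict_iff' measurableSet_Ioo] at this
  -- The null set in `h1` depends on `φ`; a countable dense family of test functions yields a common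
  -- one.
  obtain ⟨S, hS, hSc, hSd⟩ := (dense_range_toVN (Ω := Ω)).exists_countable_dense_subset
  have h2 : ∀ᵐ t ∂timeMeasure T, ∀ g ∈ S, (inner ℝ (H t - H' t) g : ℝ) = 0 := by
    rw [ae_ball_iff hSc]
    intro g hg
    obtain ⟨φ, rfl⟩ := hS hg
    exact h1 φ
  filter_upwards [h2] with t ht
  exact sub_eq_zero.1 (hSd.eq_zero_of_inner_left ℝ ht)

/-- Replaces the chosen pointwise gradients by the measurable curve `G`, whose square integrability
supplies the remaining condition of `IsHbar`. -/
theorem isWeakSolution_iff {u : ℝ → LN Ω} {r : ℝ → VN Ω} (hr : MemLp r 2 (timeMeasure T))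
    {G : ℝ → VN Ω} (hG : MemLp G 2 (timeMeasure T))
    (hGu : ∀ᵐ t ∂timeMeasure T, WithLp.toLp 2 ((u t : L2E Ω), (G t : L2M Ω)) ∈ HN Ω) :
    IsWeakSolution Ω T r u ↔ IsHbar Ω T u fun t => G t + r t := by
  have h1 : ∀ ψ : TestField Ω T, ∫ t in Ioo 0 T, ∫ x in Ω,
        (inner ℝ ((weakGrad Ω (u t : L2E Ω)) x + (r t : L2M Ω) x) (ψ.dx t x) : ℝ)
      = ∫ t in Ioo 0 T, ∫ x in Ω, inner ℝ (((G t + r t : VN Ω) : L2M Ω) x) (ψ.dx t x) := by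
    intro ψ
    refine integral_congr_ae ?_
    filter_upwards [hGu] with t ht
    refine integral_congr_ae ?_
    filter_upwards [Lp.coeFn_add (G t : L2M Ω) (r t : L2M Ω)] with x hx
    rw [weakGrad_eq ht, Submodule.coe_add, hx, Pi.add_apply]
  simp only [IsWeakSolution, IsHbar, h1]
  exact ⟨fun h => ⟨hG.add hr, h⟩, fun h => h.2⟩

end NavierStokesVar

/-! ### The minimization theorem. -/

theorem theorem5p1 {N : ℕ} (Ω : Set (NavierStokesVar.E N)) (hopen : IsOpen Ω)
    (hconn : IsConnected Ω) (hlip : NavierStokesVar.HasLipschitzBoundary Ω)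
    (T : ℝ) (hT : 0 < T) (v₀ : NavierStokesVar.LN Ω) (r : ℝ → NavierStokesVar.VN Ω)
    (hr : MemLp r 2 (NavierStokesVar.timeMeasure T))
    (u : ℝ → NavierStokesVar.LN Ω) (hu : NavierStokesVar.MemP Ω T u) (hu0 : u 0 = v₀)
    (hsol : NavierStokesVar.IsWeakSolution Ω T r u) :
    NavierStokesVar.IsMinimizer Ω T r v₀ u ∧
      ∀ w : ℝ → NavierStokesVar.LN Ω, NavierStokesVar.IsMinimizer Ω T r v₀ w →
        NavierStokesVar.IsWeakSolution Ω T r w := by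
  open NavierStokesVar in
  obtain ⟨G, hG, hGu⟩ := hu.exists_grad
  have hJu : J Ω T r u = 1 / 2 * (∫ t, ‖r t‖ ^ 2 ∂timeMeasure T + ‖v₀‖ ^ 2) := by
    rw [hu.J_eq hT hr hG hGu, hu0]
    -- Uniqueness of the representative identifies `H̄_u` with `∇u + ∇r`, so the defect of a
    -- solution is zero.
    have h1 := hu.isHbar_Hbar.ae_eq ((isWeakSolution_iff hr hG hGu).1 hsol)
    have h2 : ∫ t, ‖G t + r t - Hbar Ω T u t‖ ^ 2 ∂timeMeasure T = 0 := by
      refine integral_eq_zero_of_ae ?_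
      filter_upwards [h1] with t ht
      simp [ht]
    rw [h2, zero_add]
  refine ⟨⟨hu, hu0, fun w hw hw0 => ?_⟩, fun w ⟨hw, hw0, hmin⟩ => ?_⟩
  · obtain ⟨Gw, hGw, hGww⟩ := hw.exists_grad
    rw [hJu, hw.J_eq hT hr hGw hGww, hw0]
    have : 0 ≤ ∫ t, ‖Gw t + r t - Hbar Ω T w t‖ ^ 2 ∂timeMeasure T :=
      integral_nonneg fun t => by positivity
    linarith
  · obtain ⟨Gw, hGw, hGww⟩ := hw.exists_grad
    have h1 := hmin u hu hu0
    rw [hJu, hw.J_eq hT hr hGw hGww, hw0] at h1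
    have h0 : 0 ≤ ∫ t, ‖Gw t + r t - Hbar Ω T w t‖ ^ 2 ∂timeMeasure T :=
      integral_nonneg fun t => by positivity
    -- A minimizer cannot exceed the value attained by `u`, which is already the lower bound; its
    -- defect must vanish.
    have h2 : ∫ t, ‖Gw t + r t - Hbar Ω T w t‖ ^ 2 ∂timeMeasure T = 0 := by linarith
    have hi : Integrable (fun t => ‖Gw t + r t - Hbar Ω T w t‖ ^ 2) (timeMeasure T) :=
      ((hGw.add hr).sub hw.isHbar_Hbar.1).integrable_norm_pow two_ne_zero
    rw [integral_eq_zero_iff_of_nonneg (fun t => by positivity) hi] at h2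
    rw [isWeakSolution_iff hr hGw hGww]
    refine ⟨hGw.add hr, fun ψ => ?_⟩
    rw [hw.isHbar_Hbar.2 ψ]
    refine integral_congr_ae ?_
    filter_upwards [h2] with t ht
    have h3 : Gw t + r t = Hbar Ω T w t :=
      Subtype.ext (by simpa [sub_eq_zero] using ht)
    rw [h3]
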